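/- Consider the double integrator $\dot x_1=x_2,\ \dot x_2=u$ with measurable controls $|u(t)|\le 1$, the square $Q=[-1,1]^2$ with corners $A=(-1,1)$, $B=(-1,-1)$, $C=(1,-1)$, $D=(1,1)$, and $f(x,u)=(x_2,u)$. The Usable Part $\mathrm{UP}$ is the set of $x\in\partial Q$ with $\min_{|u|\le1}\langle n,f(x,u)\rangle<0$ for every outward unit normal $n$ of $Q$ at $x$ (at a corner the normals form a cone). A control is called optimal from $x_0$ if it steers $x_0$ to $\mathrm{UP}$ in minimum time. Then: 1. (Usable Part) $\mathrm{UP}=\{x_1=-1,\,0<x_2\le1\}\cup\{x_2=-1,\,-1<x_1\le1\}\cup\{x_1=1,\,-1\le x_2<0\}\cup\{x_2=1,\,-1\le x_1<1\}$. In particular $A,C\in\mathrm{UP}$ and $B,D\notin\mathrm{UP}$. 2. (Bang-bang feedback) From every $x_0\notin Q$ there is an optimal control, unique almost everywhere. Define $\kappa(x)=-1$ if ($x_2\ge1$ and $x_1\ge-\frac12x_2^2-\frac12$) or ($|x_2|<1$ and $x_1>1$) or ($x_2\le-1$ and $x_1>\frac12x_2^2+\frac12$), and $\kappa(x)=1$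 otherwise. A control steering $x_0\notin Q$ to $\mathrm{UP}$ at time $T$ is optimal if and only if $T$ is the first time its trajectory is in $\mathrm{UP}$ and $u(t)=\kappa(x(t))$ for almost every $t\in[0,T]$. Moreover, if $x_0\notin Q$ lies on neither of the arcs $\{x_1=\frac12x_2^2-\frac32,\ x_2<-1\}$, $\{x_1=-\frac12x_2^2+\frac32,\ x_2>1\}$, then the minimum-time controls from $x_0$ to $Q$ and those from $x_0$ to $\mathrm{UP}$ are the same. 3. (Optimal flow field) For each curve $P(\tau)$ below and each admitted $\tau$, the minimum time from $P(\tau)$ to $\mathrm{UP}$ is $\tau$, it is attained, and $t\mapsto P(\tau-t)$, $0\le t\le\tau$, is the only optimal trajectory: - $(-1-s\tau+\frac{\tau^2}2,\ s-\tau)$, $0<s\le1$, $0\le\tau\le2s$ (ending on $AB$); - $(s+\tau+\frac{\tau^2}2,\ -1-\tau)$, $-1<s\le1$, $\tau\ge0$ (ending on $BC$); - $(1-s\tau-\frac{\tau^2}2,\ s+\tau)$, $-1\le s<0$, $0\le\tau\le-2s$ (ending on $CD$); - $(s-\tau-\frac{\tau^2}2,\ 1+\tau)$, $-1\le s<1$,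 $\tau\ge0$ (ending on $AD$); - the fan ending at $A$, $\frac\pi2<\theta\le\pi$, $\tau\ge0$: $(-1-\tau-\frac{\tau^2}2,\ 1+\tau)$ if $\tau\le-\tan\theta$, and $(-1-\tau+2\tau\tan\theta+\frac{\tau^2}2+\tan^2\theta,\ 1-2\tan\theta-\tau)$ if $\tau>-\tan\theta$; - the fan ending at $C$, $\frac{3\pi}2<\theta\le2\pi$, $\tau\ge0$: $(1+\tau+\frac{\tau^2}2,\ -1-\tau)$ if $\tau\le-\tan\theta$, and $(1+\tau-2\tau\tan\theta-\frac{\tau^2}2-\tan^2\theta,\ -1+2\tan\theta+\tau)$ if $\tau>-\tan\theta$. Every point outside $Q$ lies on at least one of these curves. 4. (Switching curves) Consider all optimal controls from initial states outside $Q$. The set of points at which one of them switches, before its terminal time, from $1$ to $-1$ is $\{x_1=-\frac12x_2^2-\frac12,\ x_2>1\}$, with closure $\{x_1=-\frac12x_2^2-\frac12,\ x_2\ge1\}$. The set of points at which one of them switches from $-1$ to $1$ is $\{x_1=\frac12x_2^2+\frac12,\ x_2<-1\}$, with closure $\{x_1=\frac12x_2^2+\frac12,\ x_2\le-1\}$.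 5. (Touch-and-go) If $x_0$ satisfies $x_1=\frac12x_2^2-\frac32$, $x_2<-1$, then its optimal trajectory stays on the parabola $x_1=\frac12x_2^2-\frac32$, passes through $B$ at time $-1-x_2$, ends at $A$ at time $1-x_2$, and is in $Q$ at these two times only. If $x_0$ satisfies $x_1=-\frac12x_2^2+\frac32$, $x_2>1$, then its optimal trajectory stays on the parabola $x_1=-\frac12x_2^2+\frac32$, passes through $D$ at time $x_2-1$, ends at $C$ at time $x_2+1$, and is in $Q$ at these two times only. No other optimal trajectory that starts outside $Q$ passes through $B$ or $D$. -/

import Mathlib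

open Set MeasureTheory

noncomputable section

namespace SquareTarget

/-- Right-hand side `f(x,u) = (x₂, u)` of the double integrator `ẋ₁ = x₂`, `ẋ₂ = u`. -/
def field (x : ℝ × ℝ) (u : ℝ) : ℝ × ℝ := (x.2, u)

/-- The standard inner product of the plane. -/
def dot (a b : ℝ × ℝ) : ℝ := a.1 * b.1 + a.2 * b.2

/-- The target square `[-1,1]²`. -/
def square : Set (ℝ × ℝ) := Icc (-1) 1 ×ˢ Icc (-1) 1

def cornerA : ℝ × ℝ := (-1, 1)
def cornerB : ℝ × ℝ := (-1, -1)
def cornerC : ℝ × ℝ := (1, -1)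
def cornerD : ℝ × ℝ := (1, 1)

/-- `n` is an outward unit normal of the convex set `K` at `x`. At a corner the normals form
a nontrivial cone. -/
def IsOutwardNormal (K : Set (ℝ × ℝ)) (x n : ℝ × ℝ) : Prop :=
  dot n n = 1 ∧ ∀ y ∈ K, dot n (y - x) ≤ 0

/-- The usable part of the boundary of `K`: the boundary points `x` with
`min_{|u| ≤ 1} ⟨n, f(x,u)⟩ < 0` for every outward unit normal `n` at `x`. -/
def usablePart (K : Set (ℝ × ℝ)) : Set (ℝ × ℝ) :=
  {x | x ∈ frontier K ∧ ∀ n, IsOutwardNormal K x n →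
    sInf ((fun u => dot n (field x u)) '' Icc (-1) 1) < 0}

/-- Admissible controls: measurable with values in `[-1,1]`. -/
def IsAdmissible (u : ℝ → ℝ) : Prop := Measurable u ∧ ∀ t, u t ∈ Icc (-1 : ℝ) 1

/-- The (Carathéodory) solution of `ẋ₁ = x₂`, `ẋ₂ = u`, `x(0) = x₀`. -/
def traj (x₀ : ℝ × ℝ) (u : ℝ → ℝ) (t : ℝ) : ℝ × ℝ :=
  (x₀.1 + ∫ s in (0 : ℝ)..t, (x₀.2 + ∫ r in (0 : ℝ)..s, u r),
    x₀.2 + ∫ r in (0 : ℝ)..t, u r)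

/-- The control `u` steers `x₀` to a point of `K` at time `T`. -/
def Steers (K : Set (ℝ × ℝ)) (x₀ : ℝ × ℝ) (u : ℝ → ℝ) (T : ℝ) : Prop :=
  IsAdmissible u ∧ 0 ≤ T ∧ traj x₀ u T ∈ K

/-- `u` on `[0,T]` is a minimum-time control from `x₀` to `K`. -/
def IsOptimal (K : Set (ℝ × ℝ)) (x₀ : ℝ × ℝ) (u : ℝ → ℝ) (T : ℝ) : Prop :=
  Steers K x₀ u T ∧ ∀ v S, Steers K x₀ v S → T ≤ S

/-- The bang-bang state feedback (its values on the square itself play no role). -/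
def feedback (x : ℝ × ℝ) : ℝ :=
  open Classical in
  if (1 ≤ x.2 ∧ -(1 / 2) * x.2 ^ 2 - 1 / 2 ≤ x.1) ∨
      (-1 < x.2 ∧ x.2 < 1 ∧ 1 < x.1) ∨
      (x.2 ≤ -1 ∧ (1 / 2) * x.2 ^ 2 + 1 / 2 < x.1) then -1 else 1

/-- The curve `P`, a function of retrograde time, is at `τ` on the optimal flow field of the
usable part: from `P τ` the minimum time is `τ`, it is attained, and every minimum-time motion
is `t ↦ P (τ - t)`. -/
def IsOptimalMotion (P : ℝ → ℝ × ℝ) (τ : ℝ) : Prop :=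
  (∃ u, IsOptimal (usablePart square) (P τ) u τ) ∧
  ∀ u T, IsOptimal (usablePart square) (P τ) u T →
    T = τ ∧ ∀ t ∈ Icc 0 τ, traj (P τ) u t = P (τ - t)

/-- Retrograde motion from the point `(-1, s)` of the side `AB`. -/
def famAB (s τ : ℝ) : ℝ × ℝ := (-1 - s * τ + τ ^ 2 / 2, s - τ)

/-- Retrograde motion from the point `(s, -1)` of the side `BC`. -/
def famBC (s τ : ℝ) : ℝ × ℝ := (s + τ + τ ^ 2 / 2, -1 - τ)

/-- Retrograde motion from the point `(1, s)` of the side `CD`. -/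
def famCD (s τ : ℝ) : ℝ × ℝ := (1 - s * τ - τ ^ 2 / 2, s + τ)

/-- Retrograde motion from the point `(s, 1)` of the side `AD`. -/
def famAD (s τ : ℝ) : ℝ × ℝ := (s - τ - τ ^ 2 / 2, 1 + τ)

/-- Fan of retrograde motions from `A`, labelled by the normal `(cos θ, sin θ)`; the control
switches at retrograde time `-tan θ`. -/
def fanA (θ τ : ℝ) : ℝ × ℝ :=
  if τ ≤ -Real.tan θ then (-1 - τ - τ ^ 2 / 2, 1 + τ)
  else (-1 - τ + 2 * τ * Real.tan θ + τ ^ 2 / 2 + Real.tan θ ^ 2, 1 - 2 * Real.tan θ - τ)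

/-- Fan of retrograde motions from `C`, labelled by the normal `(cos θ, sin θ)`; the control
switches at retrograde time `-tan θ`. -/
def fanC (θ τ : ℝ) : ℝ × ℝ :=
  if τ ≤ -Real.tan θ then (1 + τ + τ ^ 2 / 2, -1 - τ)
  else (1 + τ - 2 * τ * Real.tan θ - τ ^ 2 / 2 - Real.tan θ ^ 2, -1 + 2 * Real.tan θ + τ)

/-- The points at which a minimum-time control, for some initial state outside the square,
switches from the value `a` to the value `b` before the motion ends. -/
def switchPoints (a b : ℝ) : Set (ℝ × ℝ) :=
  {p | ∃ x₀ u T, x₀ ∉ square ∧ IsOptimal (usablePart square) x₀ u T ∧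
    ∃ t ∈ Ioo 0 T, traj x₀ u t = p ∧ ∃ ε > 0,
      (∀ᵐ s ∂(volume.restrict (Ioo (t - ε) t)), u s = a) ∧
      (∀ᵐ s ∂(volume.restrict (Ioo t (t + ε))), u s = b)}

/-- The parabola of the touch-and-go motion through `B`. -/
def parabolaB : Set (ℝ × ℝ) := {x | x.1 = x.2 ^ 2 / 2 - 3 / 2}

/-- The parabola of the touch-and-go motion through `D`. -/
def parabolaD : Set (ℝ × ℝ) := {x | x.1 = -x.2 ^ 2 / 2 + 3 / 2}

/-- The part of `parabolaB` traversed before `B` is reached. -/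
def arcB : Set (ℝ × ℝ) := {x | x ∈ parabolaB ∧ x.2 < -1}

/-- The part of `parabolaD` traversed before `D` is reached. -/
def arcD : Set (ℝ × ℝ) := {x | x ∈ parabolaD ∧ 1 < x.2}

end SquareTarget

end

open Set MeasureTheory SquareTarget

namespace SquareTarget

/-! The velocity x₂ integrates the control and x₁ integrates the velocity, so trajectories increase
with the control in the componentwise order (`traj_mono`). This comparison takes the place of the
maximum principle. The symmetry (x, u) ↦ (-x, -u) preserves the problem, so it suffices to treat
motions ending on AB or AD; by `leftUpCovered_or_neg` these and their mirror images fill the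
exterior.

Motions to AD brake throughout, and are optimal because the velocity has to fall to 1. The others
accelerate for a time a, then brake for a time σ (`LeftParam.le_time`). Before arrival the
accelerating motion is strictly left of or strictly below the square, except possibly at (-1, -s),
and a competitor lies componentwise below it, hence is outside too. After time a, a competitor must
end with velocity at most 1, which bounds its earlier velocities and so the distance it can still
cover. Equality in these estimates determines the control almost everywhere.

The exceptional state (-1, -s) is not usable. For the full square as target it matters only on the
parabola through B, which gives the touch-and-go arc.

The feedback is antitone. A closed-loop motion below the reference accelerating motion must
therefore accelerate, and one above the reference braking motion must brake, so the discontinuous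
closed loop has only one solution (`IsLeftUp.closedLoop_unique`). -/

/-! ### Trajectories and comparison of controls -/

theorem IsAdmissible.intervalIntegrable {u : ℝ → ℝ} (hu : IsAdmissible u) (a b : ℝ) :
    IntervalIntegrable u volume a b := by
  refine (intervalIntegrable_const (c := (1 : ℝ))).mono_fun' hu.1.aestronglyMeasurable
    (ae_of_all _ fun t => ?_)
  simpa [abs_le] using hu.2 t

theorem IsAdmissible.neg {u : ℝ → ℝ} (hu : IsAdmissible u) : IsAdmissible (-u) :=
  ⟨hu.1.neg, fun t => ⟨neg_le_neg (hu.2 t).2, neg_le.mp (by simpa using (hu.2 t).1)⟩⟩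

theorem IsAdmissible.shift {u : ℝ → ℝ} (hu : IsAdmissible u) (a : ℝ) :
    IsAdmissible fun t => u (a + t) :=
  ⟨hu.1.comp (measurable_const_add a), fun t => hu.2 (a + t)⟩

theorem isAdmissible_const {c : ℝ} (hc : c ∈ Icc (-1 : ℝ) 1) : IsAdmissible fun _ => c :=
  ⟨measurable_const, fun _ => hc⟩

theorem IsAdmissible.continuous_velocity {u : ℝ → ℝ} (hu : IsAdmissible u) (q : ℝ) :
    Continuous fun t => q + ∫ r in (0 : ℝ)..t, u r :=
  continuous_const.add (intervalIntegral.continuous_primitive hu.intervalIntegrable 0)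

theorem traj_fst (x : ℝ × ℝ) (u : ℝ → ℝ) (t : ℝ) :
    (traj x u t).1 = x.1 + ∫ s in (0 : ℝ)..t, (traj x u s).2 := rfl

theorem traj_snd (x : ℝ × ℝ) (u : ℝ → ℝ) (t : ℝ) :
    (traj x u t).2 = x.2 + ∫ r in (0 : ℝ)..t, u r := rfl

theorem IsAdmissible.continuous_traj_snd {u : ℝ → ℝ} (hu : IsAdmissible u) (x : ℝ × ℝ) :
    Continuous fun t => (traj x u t).2 := hu.continuous_velocity x.2

theorem traj_neg (x : ℝ × ℝ) (u : ℝ → ℝ) (t : ℝ) : traj (-x) (-u) t = -traj x u t := by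
  have h2 : ∀ s, (traj (-x) (-u) s).2 = -(traj x u s).2 := fun s => by
    simp only [traj_snd, Pi.neg_apply, intervalIntegral.integral_neg, Prod.snd_neg]; ring
  ext
  · rw [traj_fst]
    simp only [h2, intervalIntegral.integral_neg, Prod.fst_neg, traj_fst x u t]; ring
  · exact h2 t

theorem traj_const (x : ℝ × ℝ) (c t : ℝ) :
    traj x (fun _ => c) t = (x.1 + x.2 * t + c * t ^ 2 / 2, x.2 + c * t) := by
  have h2 : ∀ s, (traj x (fun _ => c) s).2 = x.2 + c * s := fun s => by
    simp [traj_snd, mul_comm]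
  ext
  · rw [traj_fst]
    simp only [h2]
    rw [intervalIntegral.integral_add (by simp) (by
      exact (continuous_const.mul continuous_id).intervalIntegrable _ _)]
    rw [intervalIntegral.integral_const_mul, integral_id]
    simp
    ring
  · exact h2 t

theorem traj_add {u : ℝ → ℝ} (hu : IsAdmissible u) (x : ℝ × ℝ) (a t : ℝ) :
    traj x u (a + t) = traj (traj x u a) (fun r => u (a + r)) t := by
  have h2 : ∀ t, (traj x u (a + t)).2 = (traj (traj x u a) (fun r => u (a + r)) t).2 := by
    intro t
    rw [traj_snd, traj_snd _ (fun r => u (a + r)), traj_snd x u a,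
      intervalIntegral.integral_comp_add_left (fun r => u r) a, add_zero, add_assoc,
      intervalIntegral.integral_add_adjacent_intervals (hu.intervalIntegrable _ _)
        (hu.intervalIntegrable _ _)]
  ext
  · rw [traj_fst, traj_fst _ (fun r => u (a + r)), traj_fst x u a]
    simp only [← h2]
    rw [intervalIntegral.integral_comp_add_left (fun r => (traj x u r).2) a, add_zero, add_assoc,
      intervalIntegral.integral_add_adjacent_intervals
        ((hu.continuous_traj_snd x).intervalIntegrable _ _)
        ((hu.continuous_traj_snd x).intervalIntegrable _ _)]
  · exact h2 t

theorem traj_congr_ae {u v : ℝ → ℝ} {T : ℝ}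
    (h : ∀ᵐ t ∂(volume.restrict (Icc 0 T)), u t = v t) (x : ℝ × ℝ) {t : ℝ} (ht : t ∈ Icc 0 T) :
    traj x u t = traj x v t := by
  have h2 : ∀ t ∈ Icc 0 T, (traj x u t).2 = (traj x v t).2 := by
    intro t ht
    rw [traj_snd, traj_snd]
    congr 1
    apply intervalIntegral.integral_congr_ae
    rw [ae_restrict_iff' measurableSet_Icc] at h
    filter_upwards [h] with r hr hrt
    rw [uIoc_of_le ht.1] at hrt
    exact hr ⟨hrt.1.le, hrt.2.trans ht.2⟩
  ext
  · rw [traj_fst, traj_fst]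
    congr 1
    apply intervalIntegral.integral_congr
    intro r hr
    rw [uIcc_of_le ht.1] at hr
    exact h2 r ⟨hr.1, hr.2.trans ht.2⟩
  · exact h2 t ht

theorem traj_mono {u v : ℝ → ℝ} (hu : IsAdmissible u) (hv : IsAdmissible v) (h : u ≤ v)
    (x : ℝ × ℝ) {t : ℝ} (ht : 0 ≤ t) : traj x u t ≤ traj x v t := by
  have h2 : ∀ t, 0 ≤ t → (traj x u t).2 ≤ (traj x v t).2 := fun t ht => by
    rw [traj_snd, traj_snd]
    gcongr
    exact intervalIntegral.integral_mono ht (hu.intervalIntegrable _ _)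
      (hv.intervalIntegrable _ _) h
  refine ⟨?_, h2 t ht⟩
  rw [traj_fst, traj_fst]
  gcongr
  exact intervalIntegral.integral_mono_on ht ((hu.continuous_traj_snd x).intervalIntegrable _ _)
    ((hv.continuous_traj_snd x).intervalIntegrable _ _) fun s hs => h2 s hs.1

theorem isAdmissible_one : IsAdmissible fun _ => 1 := isAdmissible_const (by norm_num)

theorem isAdmissible_neg_one : IsAdmissible fun _ => -1 := isAdmissible_const (by norm_num)

theorem traj_le_one {u : ℝ → ℝ} (hu : IsAdmissible u) (x : ℝ × ℝ) {t : ℝ} (ht : 0 ≤ t) :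
    traj x u t ≤ traj x (fun _ => 1) t :=
  traj_mono hu isAdmissible_one (fun t => (hu.2 t).2) x ht

theorem neg_one_le_traj {u : ℝ → ℝ} (hu : IsAdmissible u) (x : ℝ × ℝ) {t : ℝ} (ht : 0 ≤ t) :
    traj x (fun _ => -1) t ≤ traj x u t :=
  traj_mono isAdmissible_neg_one hu (fun t => (hu.2 t).1) x ht

theorem ae_eq_one_of_velocity {u : ℝ → ℝ} (hu : IsAdmissible u) {x : ℝ × ℝ} {a : ℝ} (ha : 0 ≤ a)
    (h : x.2 + a ≤ (traj x u a).2) : ∀ᵐ t ∂(volume.restrict (Icc 0 a)), u t = 1 := by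
  have hi : IntervalIntegrable (fun t => 1 - u t) volume 0 a :=
    intervalIntegrable_const.sub (hu.intervalIntegrable _ _)
  have h0 : ∫ t in (0 : ℝ)..a, (1 - u t) = 0 := by
    apply le_antisymm
    · rw [intervalIntegral.integral_sub intervalIntegrable_const (hu.intervalIntegrable _ _)]
      rw [traj_snd] at h
      simp only [intervalIntegral.integral_const, smul_eq_mul]
      linarith
    · exact intervalIntegral.integral_nonneg ha fun t _ => sub_nonneg.mpr (hu.2 t).2
  rw [intervalIntegral.integral_eq_zero_iff_of_le_of_nonneg_ae ha
    (ae_of_all _ fun t => sub_nonneg.mpr (hu.2 t).2) hi] at h0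
  rw [Measure.restrict_congr_set Ioc_ae_eq_Icc.symm]
  filter_upwards [h0] with t ht
  simp only [Pi.zero_apply] at ht
  linarith

theorem ae_eq_neg_one_of_velocity {u : ℝ → ℝ} (hu : IsAdmissible u) {x : ℝ × ℝ} {a : ℝ}
    (ha : 0 ≤ a) (h : (traj x u a).2 ≤ x.2 - a) :
    ∀ᵐ t ∂(volume.restrict (Icc 0 a)), u t = -1 := by
  have := ae_eq_one_of_velocity hu.neg (x := -x) ha (by
    rw [traj_neg]; simp only [Prod.snd_neg]; linarith)
  filter_upwards [this] with t ht
  simp only [Pi.neg_apply] at ht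
  linarith

/-- A final velocity short of the maximum would, by continuity, make the integral of the velocity
strictly smaller; so maximal position forces maximal velocity. -/
theorem ae_eq_one_of_position {u : ℝ → ℝ} (hu : IsAdmissible u) {x : ℝ × ℝ} {a : ℝ} (ha : 0 ≤ a)
    (h : x.1 + x.2 * a + a ^ 2 / 2 ≤ (traj x u a).1) :
    ∀ᵐ t ∂(volume.restrict (Icc 0 a)), u t = 1 := by
  rcases ha.eq_or_lt with rfl | ha'
  · simp
  refine ae_eq_one_of_velocity hu (x := x) ha (le_of_not_gt fun hlt => ?_)
  have hle : ∀ t, 0 ≤ t → (traj x u t).2 ≤ (traj x (fun _ => 1) t).2 :=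
    fun t ht => (traj_le_one hu x ht).2
  have hlt' : (traj x u a).2 < (traj x (fun _ => 1) a).2 := by
    rw [traj_const]; simpa using hlt
  have := intervalIntegral.integral_lt_integral_of_continuousOn_of_le_of_exists_lt ha'
    (hu.continuous_traj_snd x).continuousOn
    (isAdmissible_one.continuous_traj_snd x).continuousOn (fun t ht => hle t ht.1.le)
    ⟨a, right_mem_Icc.mpr ha, hlt'⟩
  have e := traj_fst x (fun _ => 1) a
  rw [traj_const] at e
  simp only at e
  rw [traj_fst] at h
  linarith

/-- Deceleration is at most 1, so final velocity at most b means velocity at most b + (h - s) at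
time s; integrate this line. -/
theorem traj_fst_le_of_snd_le {u : ℝ → ℝ} (hu : IsAdmissible u) (x : ℝ × ℝ) {h b : ℝ}
    (hh : 0 ≤ h) (hb : (traj x u h).2 ≤ b) : (traj x u h).1 ≤ x.1 + b * h + h ^ 2 / 2 := by
  have hle : ∀ s ∈ Icc 0 h, (traj x u s).2 ≤ (b + h) + -1 * s := by
    intro s hs
    have := (neg_one_le_traj (hu.shift s) (traj x u s) (sub_nonneg.mpr hs.2)).2
    rw [← traj_add hu, traj_const] at this
    simp only [add_sub_cancel] at this
    linarith
  have e := traj_const (x.1, b + h) (-1) h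
  have e1 := congrArg Prod.fst e
  have e2 := fun s => congrArg Prod.snd (traj_const (x.1, b + h) (-1) s)
  rw [traj_fst] at e1
  simp only [e2] at e1
  have := intervalIntegral.integral_mono_on (μ := volume) hh
    ((hu.continuous_traj_snd x).intervalIntegrable _ _)
    ((by fun_prop : Continuous fun s : ℝ => (b + h) + -1 * s).intervalIntegrable 0 h) hle
  rw [traj_fst]
  nlinarith

/-! ### Central symmetry and controls with one switch -/

theorem Steers.neg {K : Set (ℝ × ℝ)} (hK : ∀ x ∈ K, -x ∈ K) {x : ℝ × ℝ} {u : ℝ → ℝ} {T : ℝ}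
    (h : Steers K x u T) : Steers K (-x) (-u) T :=
  ⟨h.1.neg, h.2.1, by rw [traj_neg]; exact hK _ h.2.2⟩

theorem steers_neg {K : Set (ℝ × ℝ)} (hK : ∀ x ∈ K, -x ∈ K) {x : ℝ × ℝ} {u : ℝ → ℝ} {T : ℝ} :
    Steers K (-x) (-u) T ↔ Steers K x u T :=
  ⟨fun h => by simpa using h.neg hK, fun h => h.neg hK⟩

theorem IsOptimal.neg {K : Set (ℝ × ℝ)} (hK : ∀ x ∈ K, -x ∈ K) {x : ℝ × ℝ} {u : ℝ → ℝ} {T : ℝ}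
    (h : IsOptimal K x u T) : IsOptimal K (-x) (-u) T :=
  ⟨h.1.neg hK, fun v S hv => h.2 (-v) S (by simpa using hv.neg hK)⟩

theorem isOptimal_neg {K : Set (ℝ × ℝ)} (hK : ∀ x ∈ K, -x ∈ K) {x : ℝ × ℝ} {u : ℝ → ℝ} {T : ℝ} :
    IsOptimal K (-x) (-u) T ↔ IsOptimal K x u T :=
  ⟨fun h => by simpa using h.neg hK, fun h => h.neg hK⟩

/-- The control that is `1` before time `a` and `-1` from then on. -/
noncomputable def bang (a t : ℝ) : ℝ := if t < a then 1 else -1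

theorem isAdmissible_bang (a : ℝ) : IsAdmissible (bang a) := by
  refine ⟨Measurable.ite measurableSet_Iio measurable_const measurable_const, fun t => ?_⟩
  unfold bang; split_ifs <;> norm_num

theorem bang_ae_eq_one (a : ℝ) : ∀ᵐ t ∂(volume.restrict (Icc 0 a)), bang a t = 1 := by
  rw [Measure.restrict_congr_set Ico_ae_eq_Icc.symm, ae_restrict_iff' measurableSet_Ico]
  exact ae_of_all _ fun t ht => if_pos ht.2

theorem traj_bang_of_le (x : ℝ × ℝ) {a t : ℝ} (ht0 : 0 ≤ t) (ht : t ≤ a) :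
    traj x (bang a) t = (x.1 + x.2 * t + t ^ 2 / 2, x.2 + t) := by
  rw [traj_congr_ae (bang_ae_eq_one a) x ⟨ht0, ht⟩, traj_const]
  simp

theorem traj_bang_of_ge (x : ℝ × ℝ) {a t : ℝ} (ha : 0 ≤ a) (ht : a ≤ t) :
    traj x (bang a) t = (x.1 + x.2 * a + a ^ 2 / 2 + (x.2 + a) * (t - a) - (t - a) ^ 2 / 2,
      x.2 + a - (t - a)) := by
  obtain ⟨h, rfl⟩ := exists_add_of_le ht
  have hh : 0 ≤ h := by linarith
  have hc : ∀ᵐ r ∂(volume.restrict (Icc 0 h)), bang a (a + r) = (fun _ => -1 : ℝ → ℝ) r := by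
    rw [ae_restrict_iff' measurableSet_Icc]
    exact ae_of_all _ fun r hr => if_neg (by linarith [hr.1])
  rw [traj_add (isAdmissible_bang a), traj_congr_ae hc _ ⟨hh, le_rfl⟩, traj_const,
    traj_bang_of_le x ha le_rfl]
  ext <;> simp <;> ring

/-- A control that is `1` up to time `a` and `-1` for the time `σ` after is `bang a`. -/
theorem ae_eq_bang {v : ℝ → ℝ} {a σ : ℝ} (h1 : ∀ᵐ t ∂(volume.restrict (Icc 0 a)), v t = 1)
    (h2 : ∀ᵐ t ∂(volume.restrict (Icc 0 σ)), v (a + t) = -1) :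
    ∀ᵐ t ∂(volume.restrict (Icc 0 (a + σ))), v t = bang a t := by
  rw [ae_restrict_iff' measurableSet_Icc] at h1 h2 ⊢
  have h2' : ∀ᵐ t, t - a ∈ Icc 0 σ → v (a + (t - a)) = -1 := by
    have := (measurePreserving_sub_right (volume : Measure ℝ) a).quasiMeasurePreserving.ae h2
    exact this
  filter_upwards [h1, h2'] with t ht1 ht2 ht
  unfold bang
  split_ifs with hta
  · exact ht1 ⟨ht.1, hta.le⟩
  · have := ht2 ⟨by linarith, by linarith [ht.2]⟩
    simpa using this

/-! ### The square and its usable part -/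

theorem mem_square {x : ℝ × ℝ} :
    x ∈ square ↔ (-1 ≤ x.1 ∧ x.1 ≤ 1) ∧ -1 ≤ x.2 ∧ x.2 ≤ 1 := by
  simp only [square, mem_prod, mem_Icc]

theorem mem_frontier_square {x : ℝ × ℝ} :
    x ∈ frontier square ↔ x ∈ square ∧ (x.1 = -1 ∨ x.1 = 1 ∨ x.2 = -1 ∨ x.2 = 1) := by
  have hc : IsClosed square := isClosed_Icc.prod isClosed_Icc
  rw [hc.frontier_eq, square, interior_prod_eq, interior_Icc]
  simp only [mem_sdiff, mem_prod, mem_Icc, mem_Ioo, not_and_or, not_lt]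
  constructor
  · rintro ⟨⟨⟨h1, h2⟩, h3, h4⟩, (h | h) | h | h⟩
    · exact ⟨⟨⟨h1, h2⟩, h3, h4⟩, .inl (le_antisymm h h1)⟩
    · exact ⟨⟨⟨h1, h2⟩, h3, h4⟩, .inr (.inl (le_antisymm h2 h))⟩
    · exact ⟨⟨⟨h1, h2⟩, h3, h4⟩, .inr (.inr (.inl (le_antisymm h h3)))⟩
    · exact ⟨⟨⟨h1, h2⟩, h3, h4⟩, .inr (.inr (.inr (le_antisymm h4 h)))⟩
  · rintro ⟨h, h' | h' | h' | h'⟩ <;> refine ⟨h, ?_⟩ <;> simp [h']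

theorem sInf_dot_field_neg_iff (n x : ℝ × ℝ) :
    sInf ((fun u => dot n (field x u)) '' Icc (-1) 1) < 0 ↔
      ∃ u ∈ Icc (-1 : ℝ) 1, n.1 * x.2 + n.2 * u < 0 := by
  have hne : ((fun u => dot n (field x u)) '' Icc (-1) 1).Nonempty :=
    (nonempty_Icc.mpr (by norm_num)).image _
  have hbdd : BddBelow ((fun u => dot n (field x u)) '' Icc (-1) 1) :=
    (isCompact_Icc.image (by unfold dot field; fun_prop)).bddBelow
  constructor
  · intro h
    obtain ⟨_, ⟨u, hu, rfl⟩, hlt⟩ := exists_lt_of_csInf_lt hne h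
    exact ⟨u, hu, hlt⟩
  · rintro ⟨u, hu, hlt⟩
    exact csInf_lt_of_lt hbdd ⟨u, hu, rfl⟩ hlt

/-- The control can oppose any nonzero vertical component of the normal, so only the horizontal
normals restrict the point. -/
theorem mem_usablePart {x : ℝ × ℝ} :
    x ∈ usablePart square ↔ (x ∈ square ∧ (x.1 = -1 ∨ x.1 = 1 ∨ x.2 = -1 ∨ x.2 = 1)) ∧
      (0 < x.2 ∧ x.1 < 1 ∨ x.2 < 0 ∧ -1 < x.1) := by
  simp only [usablePart, mem_ofPred_eq, mem_frontier_square, sInf_dot_field_neg_iff]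
  refine and_congr_right fun ⟨hx, hb⟩ => ?_
  obtain ⟨⟨h1, h2⟩, h3, h4⟩ := mem_square.mp hx
  constructor
  · intro h
    have key : ∀ c : ℝ, c * c = 1 → (∀ y ∈ square, c * (y.1 - x.1) ≤ 0) → c * x.2 < 0 := by
      intro c hc hy
      obtain ⟨u, -, hu⟩ := h (c, 0) ⟨by simp [dot, hc], fun y hy' => by
        simpa [dot] using hy y hy'⟩
      simpa using hu
    by_cases hl : x.1 = -1
    · have := key (-1) (by norm_num) fun y hy => by linarith [(mem_square.mp hy).1.1]
      left; constructor <;> linarith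
    by_cases hr : x.1 = 1
    · have := key 1 (by norm_num) fun y hy => by linarith [(mem_square.mp hy).1.2]
      right; constructor <;> linarith
    have hl' := lt_of_le_of_ne h1 (Ne.symm hl)
    have hr' := lt_of_le_of_ne h2 hr
    rcases hb with h | h | h | h
    · exact absurd h hl
    · exact absurd h hr
    · right; constructor <;> linarith
    · left; constructor <;> linarith
  · rintro h n ⟨hn, hy⟩
    simp only [dot] at hn hy
    -- The point of a vertical side at the height of x lies in the square and fixes the sign of
    -- `n.1`.
    have hn1 : n.1 * x.2 ≤ 0 ∧ (n.2 = 0 → n.1 * x.2 < 0) := by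
      rcases h with ⟨ha, hb⟩ | ⟨ha, hb⟩
      · have := hy (1, x.2) (mem_square.mpr ⟨by norm_num, h3, h4⟩)
        simp only [Prod.fst_sub, Prod.snd_sub, sub_self, mul_zero, add_zero] at this
        have h0 : n.1 ≤ 0 := by nlinarith
        refine ⟨by nlinarith, fun h20 => mul_neg_of_neg_of_pos (lt_of_le_of_ne h0 ?_) ha⟩
        rintro h10; simp [h10, h20] at hn
      · have := hy (-1, x.2) (mem_square.mpr ⟨by norm_num, h3, h4⟩)
        simp only [Prod.fst_sub, Prod.snd_sub, sub_self, mul_zero, add_zero] at this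
        have h0 : 0 ≤ n.1 := by nlinarith
        refine ⟨by nlinarith, fun h20 => mul_neg_of_pos_of_neg (lt_of_le_of_ne h0 ?_) ha⟩
        rintro h10; simp [← h10, h20] at hn
    rcases lt_trichotomy n.2 0 with h20 | h20 | h20
    · exact ⟨1, by norm_num, by linarith⟩
    · exact ⟨0, by norm_num, by linarith [hn1.2 h20]⟩
    · exact ⟨-1, by norm_num, by linarith⟩

theorem usablePart_square_eq : usablePart square =
      {x | x.1 = -1 ∧ x.2 ∈ Ioc 0 1} ∪ {x | x.1 ∈ Ioc (-1) 1 ∧ x.2 = -1} ∪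
      {x | x.1 = 1 ∧ x.2 ∈ Ico (-1) 0} ∪ {x | x.1 ∈ Ico (-1) 1 ∧ x.2 = 1} := by
  ext ⟨p, q⟩
  simp only [mem_usablePart, mem_square, mem_union, mem_ofPred_eq, mem_Ioc, mem_Ico]
  grind

theorem usablePart_subset : usablePart square ⊆ square := fun _ hx => (mem_usablePart.mp hx).1.1

theorem neg_mem_square {x : ℝ × ℝ} (hx : x ∈ square) : -x ∈ square := by
  rw [mem_square] at *
  simp only [Prod.fst_neg, Prod.snd_neg]
  grind

theorem neg_mem_usablePart {x : ℝ × ℝ} (hx : x ∈ usablePart square) : -x ∈ usablePart square := by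
  rw [mem_usablePart, mem_square] at *
  simp only [Prod.fst_neg, Prod.snd_neg]
  grind

/-! ### Motions ending on AB, at A or on AD: time bounds and uniqueness -/

/-- The state from which the control `1` during time `a`, then `-1` during time `σ`, leads to the
point `(-1, s)`. -/
noncomputable def leftPoint (s σ a : ℝ) : ℝ × ℝ :=
  (-1 - s * σ - σ ^ 2 / 2 - (s + σ) * a + a ^ 2 / 2, s + σ - a)

/-- The parameters for which that control is optimal: the motion ends at `A`, or it ends on `AB`
without switching. -/
def LeftParam (s σ a : ℝ) : Prop :=
  0 < s ∧ s ≤ 1 ∧ 0 ≤ σ ∧ 0 ≤ a ∧ (s = 1 ∨ σ = 0 ∧ a ≤ 2 * s)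

theorem traj_leftPoint_of_le (s σ : ℝ) {a t : ℝ} (ht0 : 0 ≤ t) (ht : t ≤ a) :
    traj (leftPoint s σ a) (bang a) t = leftPoint s σ (a - t) := by
  rw [traj_bang_of_le _ ht0 ht]
  ext <;> simp only [leftPoint] <;> ring

theorem traj_leftPoint_of_ge (s σ : ℝ) {a t : ℝ} (ha : 0 ≤ a) (ht : a ≤ t) :
    traj (leftPoint s σ a) (bang a) t = leftPoint s (σ - (t - a)) 0 := by
  rw [traj_bang_of_ge _ ha ht]
  ext <;> simp only [leftPoint] <;> ring

theorem LeftParam.mono {s σ a r : ℝ} (h : LeftParam s σ a) (hr0 : 0 ≤ r) (hr : r ≤ a) :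
    LeftParam s σ r := by
  obtain ⟨h1, h2, h3, h4, h5⟩ := h
  exact ⟨h1, h2, h3, hr0, h5.imp_right fun h => ⟨h.1, hr.trans h.2⟩⟩

/-- The abscissa is a convex quadratic in r with the same value -1 - sσ - σ²/2 at r = 0 and r = 2(s
+ σ). As long as the velocity is at least -1, r stays between these two, so the abscissa reaches -1
only for σ = 0, r = 2s. -/
theorem LeftParam.leftPoint_cases {s σ r : ℝ} (h : LeftParam s σ r) (hr : 0 < r + σ) :
    (leftPoint s σ r).2 < -1 ∨ (leftPoint s σ r).1 < -1 ∨
      (σ = 0 ∧ r = 2 * s ∧ leftPoint s σ r = (-1, -s)) := by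
  obtain ⟨h1, h2, h3, h4, rfl | ⟨rfl, h5⟩⟩ := h
  · simp only [leftPoint]
    by_cases hv : 1 + σ - r < -1
    · exact .inl hv
    right
    push Not at hv
    rcases h3.eq_or_lt with rfl | h3
    · rcases (show r ≤ 2 by linarith).eq_or_lt with rfl | h
      · right; norm_num
      · left; nlinarith
    · left; nlinarith
  · simp only [leftPoint]
    right
    rcases h5.eq_or_lt with rfl | h
    · right; refine ⟨trivial, rfl, ?_⟩; ext <;> simp <;> ring
    · left; nlinarith

/-- Lower time bound and uniqueness for the left motions. -/
theorem LeftParam.le_time {s σ a : ℝ} (h : LeftParam s σ a) {K : Set (ℝ × ℝ)} (hK : K ⊆ square)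
    (hend : σ = 0 → ∀ r, 0 ≤ r → r ≤ a → r = 2 * s → ∀ p ∈ K, p ≤ (-1, -s) → False)
    {v : ℝ → ℝ} {S : ℝ} (hv : Steers K (leftPoint s σ a) v S) :
    a + σ ≤ S ∧ (S = a + σ → ∀ᵐ t ∂(volume.restrict (Icc 0 (a + σ))), v t = bang a t) := by
  obtain ⟨hv, hS, hmem⟩ := hv
  obtain ⟨⟨q1, q2⟩, q3, q4⟩ := mem_square.mp (hK hmem)
  have hσ := h.2.2.1
  have ha := h.2.2.2.1
  have hcmp : ∀ t, 0 ≤ t → t ≤ a →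
      traj (leftPoint s σ a) v t ≤ leftPoint s σ (a - t) := by
    intro t ht0 ht
    have := traj_le_one hv (leftPoint s σ a) ht0
    rw [traj_const] at this
    refine this.trans (le_of_eq ?_)
    ext <;> simp only [leftPoint] <;> ring
  -- A competitor arriving by time a is componentwise below a reference state with remaining time a
  -- - S + σ. If this is positive, that state is outside the square or equals (-1, -s), the case
  -- `hend` excludes.
  have hmid : S ≤ a → a + σ ≤ S := by
    intro hSa
    by_contra! hlt
    have hle := hcmp S hS hSa
    rcases (h.mono (r := a - S) (by linarith) (by linarith)).leftPoint_cases (by linarith) with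
      h' | h' | ⟨h0, h', h''⟩
    · linarith [hle.2]
    · linarith [hle.1]
    · exact hend h0 (a - S) (by linarith) (by linarith) h' _ hmem (h'' ▸ hle)
  -- The square requires final velocity at most 1, which bounds the distance covered after time a.
  have hlate : a ≤ S → s = 1 →
      (traj (leftPoint s σ a) v S).1 ≤
        (traj (leftPoint s σ a) v a).1 + (S - a) + (S - a) ^ 2 / 2 := by
    intro haS hs
    have e := traj_add hv (leftPoint s σ a) a (S - a)
    rw [add_sub_cancel] at e
    have := traj_fst_le_of_snd_le (hv.shift a) (traj (leftPoint s σ a) v a) (b := 1)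
      (sub_nonneg.mpr haS) (by rw [← e]; exact q4)
    rw [← e] at this
    linarith
  have hca := (hcmp a ha le_rfl).1
  simp only [sub_self, leftPoint] at hca
  refine ⟨?_, ?_⟩
  · rcases le_total S a with hSa | hSa
    · exact hmid hSa
    · rcases h.2.2.2.2 with hs | ⟨h0, -⟩
      · have := hlate hSa hs
        subst hs
        by_contra! hlt
        simp only [leftPoint] at this q1
        nlinarith
      · linarith
  · rintro rfl
    -- Arrival exactly at a + σ leaves no slack: the position at time a must be the largest
    -- possible.
    have h1 : ∀ᵐ t ∂(volume.restrict (Icc 0 a)), v t = 1 := by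
      apply ae_eq_one_of_position hv ha (x := leftPoint s σ a)
      rcases h.2.2.2.2 with hs | ⟨h0, -⟩
      · have := hlate (by linarith) hs
        subst hs
        simp only [leftPoint] at this q1 ⊢
        nlinarith
      · subst h0
        simp only [leftPoint, add_zero] at q1 ⊢
        nlinarith
    refine ae_eq_bang h1 ?_
    have e := traj_add hv (leftPoint s σ a) a σ
    have e1 : traj (leftPoint s σ a) v a = leftPoint s σ 0 := by
      rw [traj_congr_ae (v := fun _ => 1) h1 _ ⟨ha, le_rfl⟩, traj_const]
      ext <;> simp only [leftPoint] <;> ring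
    -- For s = 1 the velocity must fall from 1 + σ to at most 1 within time σ; otherwise σ = 0.
    refine ae_eq_neg_one_of_velocity (hv.shift a) (x := traj (leftPoint s σ a) v a) hσ ?_
    rw [← e, e1]
    rcases h.2.2.2.2 with hs | ⟨h0, -⟩
    · subst hs
      simp only [leftPoint] at q4 ⊢
      linarith
    · subst h0
      simp only [add_zero] at q4 ⊢
      rw [e1]; simp

theorem traj_famAD (s : ℝ) {τ t : ℝ} (ht : 0 ≤ t) :
    traj (famAD s τ) (bang 0) t = famAD s (τ - t) := by
  rw [traj_bang_of_ge _ le_rfl ht]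
  ext <;> simp only [famAD] <;> ring

/-- The velocity starts at 1 + τ and must fall to at most 1, at rate at most 1. -/
theorem famAD_le_time {s τ : ℝ} (hτ : 0 ≤ τ) {K : Set (ℝ × ℝ)} (hK : K ⊆ square)
    {v : ℝ → ℝ} {S : ℝ} (hv : Steers K (famAD s τ) v S) :
    τ ≤ S ∧ (S = τ → ∀ᵐ t ∂(volume.restrict (Icc 0 τ)), v t = bang 0 t) := by
  obtain ⟨hv, hS, hmem⟩ := hv
  obtain ⟨-, -, q4⟩ := mem_square.mp (hK hmem)
  refine ⟨?_, ?_⟩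
  · have := (neg_one_le_traj hv (famAD s τ) hS).2
    rw [traj_const] at this
    simp only [famAD] at this q4
    linarith
  · rintro rfl
    have h1 : ∀ᵐ t ∂(volume.restrict (Icc 0 S)), v t = -1 := by
      apply ae_eq_neg_one_of_velocity hv hτ (x := famAD s S)
      simp only [famAD] at q4 ⊢
      linarith
    have := ae_eq_bang (v := v) (a := 0) (σ := S) (by simp) (by simpa using h1)
    simpa using this

/-- The control `bang a` is the optimal synthesis from `x`, the motion lasting time `τ` and ending
on `AB` or on `AD`. -/
def IsLeftUp (x : ℝ × ℝ) (a τ : ℝ) : Prop :=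
  (∃ s σ, LeftParam s σ a ∧ x = leftPoint s σ a ∧ τ = a + σ) ∨
  (∃ s ∈ Ico (-1 : ℝ) 1, a = 0 ∧ 0 ≤ τ ∧ x = famAD s τ)

theorem IsLeftUp.nonneg {x : ℝ × ℝ} {a τ : ℝ} (h : IsLeftUp x a τ) : 0 ≤ τ := by
  rcases h with ⟨s, σ, h, -, rfl⟩ | ⟨s, -, -, h, -⟩
  · exact add_nonneg h.2.2.2.1 h.2.2.1
  · exact h

theorem IsLeftUp.switch_mem {x : ℝ × ℝ} {a τ : ℝ} (h : IsLeftUp x a τ) : a ∈ Icc 0 τ := by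
  rcases h with ⟨s, σ, h, -, rfl⟩ | ⟨s, -, rfl, h, -⟩
  · exact ⟨h.2.2.2.1, by linarith [h.2.2.1]⟩
  · exact ⟨le_rfl, h⟩

theorem IsLeftUp.steers {x : ℝ × ℝ} {a τ : ℝ} (h : IsLeftUp x a τ) :
    Steers (usablePart square) x (bang a) τ := by
  refine ⟨isAdmissible_bang a, h.nonneg, ?_⟩
  rcases h with ⟨s, σ, h, rfl, rfl⟩ | ⟨s, hs, rfl, h, rfl⟩
  · rw [traj_leftPoint_of_ge _ _ h.2.2.2.1 (by linarith [h.2.2.1]), mem_usablePart, mem_square]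
    have := h.1
    have := h.2.1
    simp [leftPoint]
    grind
  · rw [traj_famAD _ h, mem_usablePart, mem_square]
    have := hs.1
    have := hs.2
    simp [famAD]
    grind

theorem IsLeftUp.le_time {x : ℝ × ℝ} {a τ : ℝ} (h : IsLeftUp x a τ) {v : ℝ → ℝ} {S : ℝ}
    (hv : Steers (usablePart square) x v S) :
    τ ≤ S ∧ (S = τ → ∀ᵐ t ∂(volume.restrict (Icc 0 τ)), v t = bang a t) := by
  rcases h with ⟨s, σ, h, rfl, rfl⟩ | ⟨s, hs, rfl, h, rfl⟩
  · refine h.le_time usablePart_subset ?_ hv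
    -- A usable point with abscissa -1 has positive velocity, so none lies below (-1, -s).
    rintro - r - - - p hp ⟨hp1, hp2⟩
    obtain ⟨⟨hp3, -⟩, hp4⟩ := mem_usablePart.mp hp
    have := (mem_square.mp hp3).1.1
    have := h.1
    simp only at hp1 hp2
    rcases hp4 with ⟨h1, h2⟩ | ⟨h1, h2⟩ <;> linarith
  · exact famAD_le_time h usablePart_subset hv

theorem IsLeftUp.le_time_square {x : ℝ × ℝ} {a τ : ℝ} (h : IsLeftUp x a τ) (hx : x ∉ square)
    (hxB : x ∉ arcB) {v : ℝ → ℝ} {S : ℝ} (hv : Steers square x v S) :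
    τ ≤ S ∧ (S = τ → ∀ᵐ t ∂(volume.restrict (Icc 0 τ)), v t = bang a t) := by
  rcases h with ⟨s, σ, h, rfl, rfl⟩ | ⟨s, hs, rfl, h, rfl⟩
  · refine h.le_time subset_rfl ?_ hv
    -- Passage through (-1, -s): either it is the initial state, which then lies in the square, or s
    -- = 1 and the initial state is on the parabola before B.
    rintro rfl r - hra rfl p hp -
    obtain ⟨h1, h2, -, h4, h5⟩ := h
    have ha : 2 * s < a → s = 1 := fun h => h5.resolve_right fun h' => by linarith [h'.2]
    rcases hra.eq_or_lt with rfl | hra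
    · apply hx
      rw [mem_square]
      simp only [leftPoint]
      refine ⟨⟨?_, ?_⟩, ?_, ?_⟩ <;> nlinarith
    · obtain rfl := ha hra
      apply hxB
      simp only [arcB, parabolaB, mem_ofPred_eq, leftPoint]
      constructor
      · ring
      · linarith
  · exact famAD_le_time h subset_rfl hv

/-! ### The feedback and its closed loop -/

/-- The properties of the feedback that determine the closed loop on the left and upper motions;
they are shared by `feedback` and its mirror image. -/
structure IsSynthesis (G : ℝ × ℝ → ℝ) : Prop where
  antitone : Antitone G
  below : ∀ x : ℝ × ℝ, x.2 ≤ -1 → x.1 ≤ (1 / 2) * x.2 ^ 2 + 1 / 2 → G x = 1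
  left : ∀ x : ℝ × ℝ, x.2 < 1 → x.1 < -1 → G x = 1
  aboveLeft : ∀ x : ℝ × ℝ, 1 ≤ x.2 → x.1 < -(1 / 2) * x.2 ^ 2 - 1 / 2 → G x = 1
  above : ∀ x : ℝ × ℝ, 1 ≤ x.2 → -(1 / 2) * x.2 ^ 2 - 1 / 2 ≤ x.1 → G x = -1

theorem feedback_eq_neg_one_iff {x : ℝ × ℝ} : feedback x = -1 ↔
    (1 ≤ x.2 ∧ -(1 / 2) * x.2 ^ 2 - 1 / 2 ≤ x.1) ∨ (-1 < x.2 ∧ x.2 < 1 ∧ 1 < x.1) ∨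
      (x.2 ≤ -1 ∧ (1 / 2) * x.2 ^ 2 + 1 / 2 < x.1) := by
  unfold feedback
  split_ifs with h
  · simpa using h
  · simp only [h, iff_false]; norm_num

theorem feedback_eq_one_or (x : ℝ × ℝ) : feedback x = 1 ∨ feedback x = -1 := by
  unfold feedback
  split_ifs <;> simp

theorem feedback_eq_one_iff {x : ℝ × ℝ} : feedback x = 1 ↔
    ¬ ((1 ≤ x.2 ∧ -(1 / 2) * x.2 ^ 2 - 1 / 2 ≤ x.1) ∨ (-1 < x.2 ∧ x.2 < 1 ∧ 1 < x.1) ∨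
      (x.2 ≤ -1 ∧ (1 / 2) * x.2 ^ 2 + 1 / 2 < x.1)) := by
  rw [← feedback_eq_neg_one_iff]
  rcases feedback_eq_one_or x with h | h <;> rw [h] <;> norm_num

/-- The value is -1 to the right of a boundary curve whose abscissa does not increase with x₂. -/
theorem feedback_antitone : Antitone feedback := by
  rintro ⟨p, q⟩ ⟨p', q'⟩ ⟨h1, h2⟩
  simp only at h1 h2
  rcases feedback_eq_one_or (p, q) with h | h
  · rcases feedback_eq_one_or (p', q') with h' | h' <;> rw [h, h']
    norm_num
  · rw [h, feedback_eq_neg_one_iff.mpr]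
    rw [feedback_eq_neg_one_iff] at h
    simp only at h ⊢
    rcases h with ⟨h3, h4⟩ | ⟨h3, h4, h5⟩ | ⟨h3, h4⟩
    · left; constructor <;> nlinarith
    · rcases lt_or_ge q' 1 with h6 | h6
      · right; left; exact ⟨by linarith, h6, by linarith⟩
      · left; exact ⟨h6, by nlinarith⟩
    · rcases le_or_gt q' (-1) with h7 | h7
      · right; right; exact ⟨h7, by nlinarith⟩
      rcases lt_or_ge q' 1 with h6 | h6
      · right; left; exact ⟨h7, h6, by nlinarith⟩
      · left; exact ⟨h6, by nlinarith⟩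

theorem isSynthesis_feedback : IsSynthesis feedback where
  antitone := feedback_antitone
  below x h1 h2 := feedback_eq_one_iff.mpr (by
    rintro (h | h | h) <;> linarith [h.1, h.2])
  left x h1 h2 := feedback_eq_one_iff.mpr (by
    rintro (h | h | h)
    · linarith [h.1]
    · linarith [h.2.2]
    · nlinarith [h.2, sq_nonneg x.2])
  aboveLeft x h1 h2 := feedback_eq_one_iff.mpr (by
    rintro (h | h | h)
    · linarith [h.2]
    · linarith [h.2.1]
    · linarith [h.1])
  above x h1 h2 := feedback_eq_neg_one_iff.mpr (.inl ⟨h1, h2⟩)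

/-- The mirror image differs from `feedback` only where |x₁| ≤ 1 and |x₂| < 1, which the properties
in `IsSynthesis` other than monotonicity do not mention. -/
theorem isSynthesis_neg_feedback_neg : IsSynthesis fun x => -feedback (-x) where
  antitone x y h := neg_le_neg (feedback_antitone (neg_le_neg h))
  below x h1 h2 := by
    rw [feedback_eq_neg_one_iff.mpr, neg_neg]
    left; simp only [Prod.fst_neg, Prod.snd_neg]; constructor <;> nlinarith
  left x h1 h2 := by
    rw [feedback_eq_neg_one_iff.mpr, neg_neg]
    simp only [Prod.fst_neg, Prod.snd_neg]
    rcases le_or_gt x.2 (-1) with h | h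
    · left; constructor <;> nlinarith
    · right; left; refine ⟨?_, ?_, ?_⟩ <;> linarith
  aboveLeft x h1 h2 := by
    rw [feedback_eq_neg_one_iff.mpr, neg_neg]
    right; right; simp only [Prod.fst_neg, Prod.snd_neg]; constructor <;> nlinarith
  above x h1 h2 := by
    rw [feedback_eq_one_iff.mpr]
    simp only [Prod.fst_neg, Prod.snd_neg]
    rintro (h | h | h)
    · linarith [h.1]
    · linarith [h.1]
    · nlinarith [h.2]

/-- `hr'` leaves out the state (-1, -s) with s < 1, a point of the left side at which `IsSynthesis`
prescribes no value. -/
theorem IsSynthesis.leftPoint_eq_one {G : ℝ × ℝ → ℝ} (hG : IsSynthesis G) {s σ r : ℝ}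
    (h : LeftParam s σ r) (hr : 0 < r) (hr' : s = 1 ∨ r < 2 * s) : G (leftPoint s σ r) = 1 := by
  obtain ⟨h1, h2, h3, -, h5⟩ := h
  rcases le_or_gt (leftPoint s σ r).2 (-1) with hv | hv
  · refine hG.below _ hv ?_
    simp only [leftPoint] at hv ⊢
    rcases h5 with rfl | ⟨rfl, h5⟩ <;> nlinarith
  rcases lt_or_ge (leftPoint s σ r).2 1 with hv' | hv'
  · refine hG.left _ hv' ?_
    simp only [leftPoint] at hv hv' ⊢
    rcases h5 with rfl | ⟨rfl, h5⟩
    · nlinarith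
    · rcases hr' with rfl | hr' <;> nlinarith
  · refine hG.aboveLeft _ hv' ?_
    simp only [leftPoint] at hv hv' ⊢
    rcases h5 with rfl | ⟨rfl, h5⟩
    · nlinarith
    · linarith

theorem IsSynthesis.leftPoint_eq_neg_one {G : ℝ × ℝ → ℝ} (hG : IsSynthesis G) {σ : ℝ}
    (hσ : 0 ≤ σ) : G (leftPoint 1 σ 0) = -1 := by
  refine hG.above _ ?_ ?_ <;> simp only [leftPoint] <;> nlinarith

theorem IsSynthesis.famAD_eq_neg_one {G : ℝ × ℝ → ℝ} (hG : IsSynthesis G) {s τ : ℝ}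
    (hs : -1 ≤ s) (hτ : 0 ≤ τ) : G (famAD s τ) = -1 := by
  refine hG.above _ ?_ ?_ <;> simp only [famAD] <;> nlinarith

/-- Along the motion the feedback takes the values of the control. -/
theorem IsLeftUp.synthesis_eq {G : ℝ × ℝ → ℝ} (hG : IsSynthesis G) {x : ℝ × ℝ} {a τ : ℝ}
    (h : IsLeftUp x a τ) {t : ℝ} (ht : t ∈ Ioo 0 τ) : G (traj x (bang a) t) = bang a t := by
  rcases h with ⟨s, σ, h, rfl, rfl⟩ | ⟨s, hs, rfl, h, rfl⟩
  · rcases lt_or_ge t a with hta | hta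
    · rw [traj_leftPoint_of_le _ _ ht.1.le hta.le, bang, if_pos hta]
      refine hG.leftPoint_eq_one (h.mono (by linarith) (by linarith [ht.1])) (by linarith) ?_
      exact h.2.2.2.2.imp_right fun h => by linarith [h.2, ht.1]
    · rw [traj_leftPoint_of_ge _ _ h.2.2.2.1 hta, bang, if_neg hta.not_gt]
      rcases h.2.2.2.2 with rfl | ⟨rfl, -⟩
      · exact hG.leftPoint_eq_neg_one (by linarith [ht.2])
      · linarith [ht.2]
  · rw [traj_famAD _ ht.1.le, bang, if_neg ht.1.not_gt]
    exact hG.famAD_eq_neg_one hs.1 (by linarith [ht.2])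

theorem ae_Ioo_of_Icc {P : ℝ → Prop} {T : ℝ} (h : ∀ᵐ t ∂(volume.restrict (Icc 0 T)), P t) :
    ∀ᵐ t, t ∈ Ioo 0 T → P t := by
  rw [Measure.restrict_congr_set Ioo_ae_eq_Icc.symm, ae_restrict_iff' measurableSet_Ioo] at h
  exact h

theorem ae_Icc_of_Ioo {P : ℝ → Prop} {T : ℝ} (h : ∀ᵐ t, t ∈ Ioo 0 T → P t) :
    ∀ᵐ t ∂(volume.restrict (Icc 0 T)), P t := by
  rwa [Measure.restrict_congr_set Ioo_ae_eq_Icc.symm, ae_restrict_iff' measurableSet_Ioo]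

/-- A closed-loop motion agrees with the motion of `bang a` for as long as both last. -/
theorem IsLeftUp.closedLoop_unique {G : ℝ × ℝ → ℝ} (hG : IsSynthesis G) {x : ℝ × ℝ} {a τ : ℝ}
    (h : IsLeftUp x a τ) {u : ℝ → ℝ} {T : ℝ} (hu : IsAdmissible u)
    (hTτ : T ≤ τ) (hcl : ∀ᵐ t ∂(volume.restrict (Icc 0 T)), u t = G (traj x u t)) :
    ∀ᵐ t ∂(volume.restrict (Icc 0 T)), u t = bang a t := by
  have ha := h.switch_mem.1
  have hcl := ae_Ioo_of_Icc hcl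
  -- Before the switch the reference motion is the largest one, so antitonicity makes the feedback
  -- along `u` at least 1.
  have h1 : ∀ᵐ t, t ∈ Ioo 0 (min a T) → u t = 1 := by
    filter_upwards [hcl] with t ht htm
    have hta := (lt_min_iff.mp htm.2).1
    have htT := (lt_min_iff.mp htm.2).2
    have hle := traj_le_one hu x htm.1.le
    have e : traj x (fun _ => 1) t = traj x (bang a) t := by
      rw [traj_const, traj_bang_of_le _ htm.1.le hta.le]; simp
    have := hG.antitone hle
    rw [e, h.synthesis_eq hG ⟨htm.1, by linarith⟩, bang, if_pos hta, ← ht ⟨htm.1, htT⟩] at this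
    exact le_antisymm (hu.2 t).2 this
  have h1' : ∀ᵐ t ∂(volume.restrict (Icc 0 (min a T))), u t = bang a t := by
    apply ae_Icc_of_Ioo
    filter_upwards [h1] with t ht htm
    rw [ht htm, bang, if_pos (lt_min_iff.mp htm.2).1]
  rcases le_total T a with hTa | hTa
  · rwa [min_eq_right hTa] at h1'
  rw [min_eq_left hTa] at h1'
  apply ae_Icc_of_Ioo
  filter_upwards [ae_Ioo_of_Icc h1', hcl, (measure_eq_zero_iff_ae_notMem.mp
    (measure_singleton (μ := volume) a))] with t ht1 ht htne htT
  rcases lt_or_ge t a with hta | hta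
  · exact ht1 ⟨htT.1, hta⟩
  -- From the common state at time a the reference motion is the smallest one, so the feedback along
  -- `u` is at most -1.
  have hle : traj x (bang a) t ≤ traj x u t := by
    have e1 := traj_add (isAdmissible_bang a) x a (t - a)
    have e2 := traj_add hu x a (t - a)
    rw [add_sub_cancel] at e1 e2
    rw [e1, e2, traj_congr_ae h1' x ⟨ha, le_rfl⟩]
    have := neg_one_le_traj (hu.shift a) (traj x (bang a) a) (sub_nonneg.mpr hta)
    refine le_trans (le_of_eq ?_) this
    refine traj_congr_ae (T := t - a) ?_ _ ⟨sub_nonneg.mpr hta, le_rfl⟩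
    rw [ae_restrict_iff' measurableSet_Icc]
    exact ae_of_all _ fun r hr => if_neg (by linarith [hr.1])
  have := hG.antitone hle
  rw [h.synthesis_eq hG ⟨htT.1, by linarith [htT.2]⟩, ← ht htT, bang, if_neg hta.not_gt] at this
  rw [bang, if_neg hta.not_gt]
  exact le_antisymm this (hu.2 t).1

/-! ### Optimality, feedback form and the full square as target -/

theorem IsLeftUp.isOptimal {x : ℝ × ℝ} {a τ : ℝ} (h : IsLeftUp x a τ) :
    IsOptimal (usablePart square) x (bang a) τ :=
  ⟨h.steers, fun _ _ hv => (h.le_time hv).1⟩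

theorem IsLeftUp.eq_of_isOptimal {x : ℝ × ℝ} {a τ : ℝ} (h : IsLeftUp x a τ) {u : ℝ → ℝ} {T : ℝ}
    (hu : IsOptimal (usablePart square) x u T) :
    T = τ ∧ ∀ᵐ t ∂(volume.restrict (Icc 0 τ)), u t = bang a t := by
  have hT : T = τ := le_antisymm (hu.2 _ _ h.steers) (h.le_time hu.1).1
  exact ⟨hT, (h.le_time hu.1).2 hT⟩

theorem IsLeftUp.traj_of_isOptimal {x : ℝ × ℝ} {a τ : ℝ} (h : IsLeftUp x a τ) {u : ℝ → ℝ} {T : ℝ}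
    (hu : IsOptimal (usablePart square) x u T) {t : ℝ} (ht : t ∈ Icc 0 τ) :
    traj x u t = traj x (bang a) t :=
  traj_congr_ae (h.eq_of_isOptimal hu).2 x ht

theorem IsLeftUp.isOptimal_of_ae_eq {x : ℝ × ℝ} {a τ : ℝ} (h : IsLeftUp x a τ) {u : ℝ → ℝ}
    (hu : IsAdmissible u) (he : ∀ᵐ t ∂(volume.restrict (Icc 0 τ)), u t = bang a t) :
    IsOptimal (usablePart square) x u τ :=
  ⟨⟨hu, h.nonneg, by
    rw [traj_congr_ae he x ⟨h.nonneg, le_rfl⟩]; exact h.steers.2.2⟩, h.isOptimal.2⟩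

/-- Existence, uniqueness and feedback form (with feedback `G`) of the minimum-time control
from `x`. -/
def HasFeedbackSynthesis (G : ℝ × ℝ → ℝ) (x : ℝ × ℝ) : Prop :=
  (∃ u T, IsOptimal (usablePart square) x u T) ∧
  (∀ u T v S, IsOptimal (usablePart square) x u T → IsOptimal (usablePart square) x v S →
    T = S ∧ ∀ᵐ t ∂(volume.restrict (Icc 0 T)), u t = v t) ∧
  (∀ u T, IsOptimal (usablePart square) x u T ↔
    Steers (usablePart square) x u T ∧
    (∀ t ∈ Ico 0 T, traj x u t ∉ usablePart square) ∧
    ∀ᵐ t ∂(volume.restrict (Icc 0 T)), u t = G (traj x u t))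

theorem IsLeftUp.hasFeedbackSynthesis {G : ℝ × ℝ → ℝ} (hG : IsSynthesis G) {x : ℝ × ℝ} {a τ : ℝ}
    (h : IsLeftUp x a τ) : HasFeedbackSynthesis G x := by
  refine ⟨⟨_, _, h.isOptimal⟩, fun u T v S hu hv => ?_, fun u T => ⟨fun hu => ?_, ?_⟩⟩
  · obtain ⟨rfl, hu'⟩ := h.eq_of_isOptimal hu
    obtain ⟨rfl, hv'⟩ := h.eq_of_isOptimal hv
    refine ⟨rfl, ?_⟩
    filter_upwards [hu', hv'] with t h1 h2
    rw [h1, h2]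
  · refine ⟨hu.1, fun t ht hmem => ?_, ?_⟩
    · exact (hu.2 u t ⟨hu.1.1, ht.1, hmem⟩).not_gt ht.2
    · obtain ⟨rfl, hu'⟩ := h.eq_of_isOptimal hu
      apply ae_Icc_of_Ioo
      filter_upwards [ae_Ioo_of_Icc hu'] with t ht htm
      rw [h.traj_of_isOptimal hu (Ioo_subset_Icc_self htm), h.synthesis_eq hG htm, ht htm]
  · rintro ⟨hst, hfirst, hcl⟩
    have hτT := (h.le_time hst).1
    have hcl' : ∀ᵐ t ∂(volume.restrict (Icc 0 τ)), u t = G (traj x u t) :=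
      ae_restrict_of_ae_restrict_of_subset (Icc_subset_Icc_right hτT) hcl
    have hopt := h.isOptimal_of_ae_eq hst.1 (h.closedLoop_unique hG hst.1 le_rfl hcl')
    -- The closed loop is already in the usable part at time τ, so a first arrival at T excludes τ <
    -- T.
    rcases hτT.eq_or_lt with rfl | hlt
    · exact hopt
    · exact absurd hopt.1.2.2 (hfirst τ ⟨h.nonneg, hlt⟩)

theorem neg_mem_usablePart_iff {x : ℝ × ℝ} : -x ∈ usablePart square ↔ x ∈ usablePart square :=
  ⟨fun h => by simpa using neg_mem_usablePart h, neg_mem_usablePart⟩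

theorem neg_mem_square_iff {x : ℝ × ℝ} : -x ∈ square ↔ x ∈ square :=
  ⟨fun h => by simpa using neg_mem_square h, neg_mem_square⟩

theorem isOptimal_usablePart_neg {x : ℝ × ℝ} {u : ℝ → ℝ} {T : ℝ} :
    IsOptimal (usablePart square) (-x) (-u) T ↔ IsOptimal (usablePart square) x u T :=
  isOptimal_neg fun _ => neg_mem_usablePart

theorem HasFeedbackSynthesis.neg {G : ℝ × ℝ → ℝ} {x : ℝ × ℝ}
    (h : HasFeedbackSynthesis (fun y => -G (-y)) (-x)) : HasFeedbackSynthesis G x := by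
  obtain ⟨⟨u, T, hu⟩, h2, h3⟩ := h
  refine ⟨⟨-u, T, by simpa using isOptimal_usablePart_neg.mpr hu⟩, fun u T v S hu hv => ?_,
    fun u T => ?_⟩
  · have := h2 (-u) T (-v) S (isOptimal_usablePart_neg.mpr hu) (isOptimal_usablePart_neg.mpr hv)
    simpa only [Pi.neg_apply, neg_inj] using this
  · rw [← isOptimal_usablePart_neg, h3, steers_neg fun _ => neg_mem_usablePart]
    simp only [traj_neg, neg_mem_usablePart_iff, neg_neg, Pi.neg_apply, neg_inj]

theorem IsLeftUp.isOptimal_square_iff {x : ℝ × ℝ} {a τ : ℝ} (h : IsLeftUp x a τ)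
    (hx : x ∉ square) (hxB : x ∉ arcB) (u : ℝ → ℝ) (T : ℝ) :
    IsOptimal square x u T ↔ IsOptimal (usablePart square) x u T := by
  have hsq : Steers square x (bang a) τ := ⟨h.steers.1, h.nonneg, usablePart_subset h.steers.2.2⟩
  constructor
  · intro hu
    have hT : T = τ := le_antisymm (hu.2 _ _ hsq) (h.le_time_square hx hxB hu.1).1
    have := (h.le_time_square hx hxB hu.1).2 hT
    subst hT
    exact h.isOptimal_of_ae_eq hu.1.1 this
  · intro hu
    obtain ⟨rfl, -⟩ := h.eq_of_isOptimal hu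
    exact ⟨⟨hu.1.1, hu.1.2.1, usablePart_subset hu.1.2.2⟩,
      fun v S hv => (h.le_time_square hx hxB hv).1⟩

theorem neg_mem_arcB_iff {x : ℝ × ℝ} : -x ∈ arcB ↔ x ∈ arcD := by
  simp only [arcB, arcD, parabolaB, parabolaD, mem_ofPred_eq, Prod.fst_neg, Prod.snd_neg]
  constructor <;> rintro ⟨h1, h2⟩ <;> constructor <;> linarith

theorem IsLeftUp.isOptimalMotion {P : ℝ → ℝ × ℝ} {a τ : ℝ} (h : IsLeftUp (P τ) a τ)
    (hP : ∀ t ∈ Icc 0 τ, traj (P τ) (bang a) t = P (τ - t)) : IsOptimalMotion P τ := by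
  refine ⟨⟨_, h.isOptimal⟩, fun u T hu => ⟨(h.eq_of_isOptimal hu).1, fun t ht => ?_⟩⟩
  rw [h.traj_of_isOptimal hu ht, hP t ht]

theorem IsOptimalMotion.neg {P Q : ℝ → ℝ × ℝ} {τ : ℝ} (h : IsOptimalMotion P τ)
    (hQ : ∀ t, Q t = -P t) : IsOptimalMotion Q τ := by
  obtain rfl : Q = fun t => -P t := funext hQ
  obtain ⟨⟨u, hu⟩, h2⟩ := h
  refine ⟨⟨-u, isOptimal_usablePart_neg.mpr hu⟩, fun v T hv => ?_⟩
  have hv' : IsOptimal (usablePart square) (P τ) (-v) T := by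
    simpa using isOptimal_usablePart_neg.mpr hv
  obtain ⟨rfl, h3⟩ := h2 _ _ hv'
  refine ⟨rfl, fun t ht => ?_⟩
  have := traj_neg (P T) (-v) t
  rw [neg_neg] at this
  rw [this, h3 t ht]

/-! ### The families and fans of the flow field -/

theorem isLeftUp_famAB {s τ : ℝ} (hs : s ∈ Ioc (0 : ℝ) 1) (hτ : τ ∈ Icc 0 (2 * s)) :
    IsLeftUp (famAB s τ) τ τ := by
  refine .inl ⟨s, 0, ⟨hs.1, hs.2, le_rfl, hτ.1, .inr ⟨rfl, hτ.2⟩⟩, ?_, by ring⟩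
  ext <;> simp only [famAB, leftPoint] <;> ring

theorem isLeftUp_famAD {s τ : ℝ} (hs : s ∈ Ico (-1 : ℝ) 1) (hτ : 0 ≤ τ) :
    IsLeftUp (famAD s τ) 0 τ :=
  .inr ⟨s, hs, rfl, hτ, rfl⟩

theorem fanA_of_le {θ τ : ℝ} (h : τ ≤ -Real.tan θ) : fanA θ τ = famAD (-1) τ := by
  rw [fanA, if_pos h, famAD]

theorem fanA_of_ge {θ τ : ℝ} (h : -Real.tan θ ≤ τ) :
    fanA θ τ = leftPoint 1 (-Real.tan θ) (τ - -Real.tan θ) := by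
  rcases h.eq_or_lt with h | h
  · rw [fanA, if_pos h.ge, ← h]
    ext <;> simp only [leftPoint] <;> ring
  · rw [fanA, if_neg h.not_ge]
    ext <;> simp only [leftPoint] <;> ring

theorem neg_tan_nonneg_of_mem {θ : ℝ} (hθ : θ ∈ Ioc (Real.pi / 2) Real.pi) : 0 ≤ -Real.tan θ := by
  rw [← Real.tan_sub_pi, neg_nonneg]
  exact Real.tan_nonpos_of_nonpos_of_neg_pi_div_two_le (by linarith [hθ.2]) (by linarith [hθ.1])

/-- Every braking time occurs in the fan: the angle is only a label for it. -/
theorem exists_angle {σ : ℝ} (hσ : 0 ≤ σ) : ∃ θ ∈ Ioc (Real.pi / 2) Real.pi, -Real.tan θ = σ := by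
  refine ⟨Real.pi - Real.arctan σ, ⟨?_, ?_⟩, ?_⟩
  · linarith [Real.arctan_lt_pi_div_two σ]
  · linarith [Real.arctan_nonneg.mpr hσ]
  · rw [Real.tan_pi_sub, Real.tan_arctan, neg_neg]

theorem isOptimalMotion_famAB {s τ : ℝ} (hs : s ∈ Ioc (0 : ℝ) 1) (hτ : τ ∈ Icc 0 (2 * s)) :
    IsOptimalMotion (famAB s) τ := by
  refine (isLeftUp_famAB hs hτ).isOptimalMotion fun t ht => ?_
  rw [traj_bang_of_le _ ht.1 ht.2]
  ext <;> simp only [famAB] <;> ring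

theorem isOptimalMotion_famAD {s τ : ℝ} (hs : s ∈ Ico (-1 : ℝ) 1) (hτ : 0 ≤ τ) :
    IsOptimalMotion (famAD s) τ :=
  (isLeftUp_famAD hs hτ).isOptimalMotion fun _ ht => traj_famAD s ht.1

theorem leftParam_one {σ a : ℝ} (hσ : 0 ≤ σ) (ha : 0 ≤ a) : LeftParam 1 σ a :=
  ⟨one_pos, le_rfl, hσ, ha, .inl rfl⟩

theorem isLeftUp_fanA_of_ge {θ τ : ℝ} (hθ : θ ∈ Ioc (Real.pi / 2) Real.pi)
    (h : -Real.tan θ ≤ τ) : IsLeftUp (fanA θ τ) (τ - -Real.tan θ) τ :=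
  .inl ⟨1, -Real.tan θ, leftParam_one (neg_tan_nonneg_of_mem hθ) (by linarith), fanA_of_ge h, by ring⟩

theorem isLeftUp_fanA_of_le {θ τ : ℝ} (hτ : 0 ≤ τ) (h : τ ≤ -Real.tan θ) :
    IsLeftUp (fanA θ τ) 0 τ := by
  rw [fanA_of_le h]
  exact isLeftUp_famAD (by norm_num) hτ

theorem isOptimalMotion_fanA {θ τ : ℝ} (hθ : θ ∈ Ioc (Real.pi / 2) Real.pi) (hτ : 0 ≤ τ) :
    IsOptimalMotion (fanA θ) τ := by
  rcases le_total τ (-Real.tan θ) with h | h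
  · refine (isLeftUp_fanA_of_le hτ h).isOptimalMotion fun t ht => ?_
    rw [fanA_of_le h, traj_famAD _ ht.1, fanA_of_le (by linarith [ht.1])]
  · refine (isLeftUp_fanA_of_ge hθ h).isOptimalMotion fun t ht => ?_
    rw [fanA_of_ge h]
    rcases le_total t (τ - -Real.tan θ) with hta | hta
    · rw [traj_leftPoint_of_le _ _ ht.1 hta, fanA_of_ge (by linarith)]
      congr 1; ring
    · rw [traj_leftPoint_of_ge _ _ (by linarith) hta, fanA_of_le (by linarith)]
      ext <;> simp only [leftPoint, famAD] <;> ring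

theorem famBC_eq_neg (s τ : ℝ) : famBC s τ = -famAD (-s) τ := by
  ext <;> simp only [famBC, famAD, Prod.fst_neg, Prod.snd_neg] <;> ring

theorem famCD_eq_neg (s τ : ℝ) : famCD s τ = -famAB (-s) τ := by
  ext <;> simp only [famCD, famAB, Prod.fst_neg, Prod.snd_neg] <;> ring

theorem fanC_eq_neg (θ τ : ℝ) : fanC θ τ = -fanA (θ - Real.pi) τ := by
  unfold fanC fanA
  rw [Real.tan_sub_pi]
  split_ifs <;> ext <;> simp only [Prod.fst_neg, Prod.snd_neg] <;> ring

/-! ### Covering the exterior -/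

/-- The points filled by the motions that end on `AB`, on `AD` or at `A`. -/
def LeftUpCovered (x : ℝ × ℝ) : Prop :=
  (∃ s ∈ Ioc (0 : ℝ) 1, ∃ τ ∈ Icc 0 (2 * s), x = famAB s τ) ∨
  (∃ s ∈ Ico (-1 : ℝ) 1, ∃ τ ≥ 0, x = famAD s τ) ∨
  (∃ θ ∈ Ioc (Real.pi / 2) Real.pi, ∃ τ ≥ 0, x = fanA θ τ)

theorem LeftUpCovered.isLeftUp {x : ℝ × ℝ} (h : LeftUpCovered x) : ∃ a τ, IsLeftUp x a τ := by
  rcases h with ⟨s, hs, τ, hτ, rfl⟩ | ⟨s, hs, τ, hτ, rfl⟩ | ⟨θ, hθ, τ, hτ, rfl⟩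
  · exact ⟨_, _, isLeftUp_famAB hs hτ⟩
  · exact ⟨_, _, isLeftUp_famAD hs hτ⟩
  · rcases le_total τ (-Real.tan θ) with h | h
    · exact ⟨_, _, isLeftUp_fanA_of_le hτ h⟩
    · exact ⟨_, _, isLeftUp_fanA_of_ge hθ h⟩

theorem leftUpCovered_fan {x : ℝ × ℝ} (h : 3 ≤ x.2 ^ 2 - 2 * x.1)
    (h' : x.2 ≤ 1 ∨ x.1 ≤ -(1 / 2) * x.2 ^ 2 - 1 / 2) : LeftUpCovered x := by
  have hnn : 1 ≤ (x.2 ^ 2 - 1) / 2 - x.1 := by linarith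
  -- m is the peak velocity: acceleration from x₂ to m and braking from m to 1 advance x₁ by (m² -
  -- x₂²)/2 + (m² - 1)/2, which must equal -1 - x₁.
  set m := Real.sqrt ((x.2 ^ 2 - 1) / 2 - x.1) with hm
  have hm1 : 1 ≤ m := by rw [hm, Real.one_le_sqrt]; exact hnn
  have hm2 : m ^ 2 = (x.2 ^ 2 - 1) / 2 - x.1 := Real.sq_sqrt (by linarith)
  have hxm : x.2 ≤ m := by
    rcases h' with h' | h'
    · linarith
    · exact Real.le_sqrt_of_sq_le (by linarith)
  obtain ⟨θ, hθ, hσ⟩ := exists_angle (sub_nonneg.mpr hm1)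
  refine .inr (.inr ⟨θ, hθ, (m - x.2) + (m - 1), by simp only [ge_iff_le]; linarith, ?_⟩)
  rw [fanA_of_ge (by linarith), hσ]
  ext <;> simp only [leftPoint]
  · linear_combination hm2
  · ring

theorem leftUpCovered_side {x : ℝ × ℝ} (h2 : 2 < x.2 ^ 2 - 2 * x.1)
    (h3 : x.2 ^ 2 - 2 * x.1 ≤ 3) (h1 : x.1 ≤ -1) : LeftUpCovered x := by
  -- x₂² - 2x₁ is constant while u = 1 and equals s² + 2 at (-1, s).
  set s := Real.sqrt (x.2 ^ 2 - 2 * x.1 - 2) with hs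
  have hs0 : 0 < s := Real.sqrt_pos.mpr (by linarith)
  have hs2 : s ^ 2 = x.2 ^ 2 - 2 * x.1 - 2 := Real.sq_sqrt (by linarith)
  -- Since x₁ ≤ -1, |x₂| ≤ s; this puts the duration s - x₂ in [0, 2s].
  have hq := abs_le_of_sq_le_sq' (show x.2 ^ 2 ≤ s ^ 2 by linarith) hs0.le
  refine .inl ⟨s, ⟨hs0, by nlinarith⟩, s - x.2, ⟨by linarith [hq.2], by linarith [hq.1]⟩, ?_⟩
  ext <;> simp only [famAB]
  · linear_combination hs2 / 2
  · ring

theorem leftUpCovered_top {x : ℝ × ℝ} (h : 1 ≤ x.2) (hl : -(1 / 2) * x.2 ^ 2 - 1 / 2 ≤ x.1)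
    (hr : x.1 < 3 / 2 - x.2 ^ 2 / 2) : LeftUpCovered x := by
  refine .inr (.inl ⟨x.1 + x.2 ^ 2 / 2 - 1 / 2, ⟨by linarith, by linarith⟩, x.2 - 1,
    by simpa using h, ?_⟩)
  ext <;> simp only [famAD] <;> ring

theorem leftUpCovered_of_left {x : ℝ × ℝ} (h : |x.2| ≤ 1) (hx : x.1 < -1) : LeftUpCovered x := by
  rcases le_total (x.2 ^ 2 - 2 * x.1) 3 with h3 | h3
  · exact leftUpCovered_side (by nlinarith [sq_nonneg x.2]) h3 hx.le
  · exact leftUpCovered_fan h3 (.inl (abs_le.mp h).2)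

theorem leftUpCovered_of_above {x : ℝ × ℝ} (h : 1 < x.2) (hr : x.1 < 3 / 2 - x.2 ^ 2 / 2) :
    LeftUpCovered x := by
  rcases le_total (-(1 / 2) * x.2 ^ 2 - 1 / 2) x.1 with hl | hl
  · exact leftUpCovered_top h.le hl hr
  · exact leftUpCovered_fan (by nlinarith) (.inr hl)

/-- Above the square, the parabola through D separates the states treated directly from those, on it
or to its right, that belong to the fan of C. Below the square the parabola through B does the same.
-/
theorem leftUpCovered_or_neg {x : ℝ × ℝ} (hx : x ∉ square) :
    LeftUpCovered x ∨ LeftUpCovered (-x) := by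
  rcases lt_or_ge 1 x.2 with h | h
  · rcases lt_or_ge x.1 (3 / 2 - x.2 ^ 2 / 2) with hr | hr
    · exact .inl (leftUpCovered_of_above h hr)
    · refine .inr (leftUpCovered_fan ?_ (.inl ?_)) <;>
        simp only [Prod.fst_neg, Prod.snd_neg] <;> nlinarith
  rcases lt_or_ge x.2 (-1) with h' | h'
  · rcases lt_or_ge (x.2 ^ 2 / 2 - 3 / 2) x.1 with hr | hr
    · refine .inr (leftUpCovered_of_above ?_ ?_) <;>
        simp only [Prod.fst_neg, Prod.snd_neg] <;> nlinarith
    · exact .inl (leftUpCovered_fan (by linarith) (.inl (by linarith)))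
  have habs : |x.2| ≤ 1 := abs_le.mpr ⟨h', h⟩
  rcases lt_or_ge x.1 (-1) with hl | hl
  · exact .inl (leftUpCovered_of_left habs hl)
  · refine .inr (leftUpCovered_of_left (by simpa using habs) ?_)
    by_contra! hr
    simp only [Prod.fst_neg] at hr
    exact hx (mem_square.mpr ⟨⟨hl, by linarith⟩, h', h⟩)

theorem isLeftUp_or_neg {x : ℝ × ℝ} (hx : x ∉ square) :
    (∃ a τ, IsLeftUp x a τ) ∨ ∃ a τ, IsLeftUp (-x) a τ :=
  (leftUpCovered_or_neg hx).imp LeftUpCovered.isLeftUp LeftUpCovered.isLeftUp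

theorem LeftUpCovered.neg_cases {x : ℝ × ℝ} (h : LeftUpCovered (-x)) :
    (∃ s ∈ Ioc (-1 : ℝ) 1, ∃ τ ≥ 0, x = famBC s τ) ∨
    (∃ s ∈ Ico (-1 : ℝ) 0, ∃ τ ∈ Icc 0 (-2 * s), x = famCD s τ) ∨
    (∃ θ ∈ Ioc (3 * Real.pi / 2) (2 * Real.pi), ∃ τ ≥ 0, x = fanC θ τ) := by
  rcases h with ⟨s, hs, τ, hτ, h⟩ | ⟨s, hs, τ, hτ, h⟩ | ⟨θ, hθ, τ, hτ, h⟩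
  · refine .inr (.inl ⟨-s, ⟨by linarith [hs.2], by linarith [hs.1]⟩, τ,
      ⟨hτ.1, by linarith [hτ.2]⟩, ?_⟩)
    rw [famCD_eq_neg, neg_neg, ← h, neg_neg]
  · refine .inl ⟨-s, ⟨by linarith [hs.2], by linarith [hs.1]⟩, τ, hτ, ?_⟩
    rw [famBC_eq_neg, neg_neg, ← h, neg_neg]
  · refine .inr (.inr ⟨θ + Real.pi, ⟨by linarith [hθ.1], by linarith [hθ.2]⟩, τ, hτ, ?_⟩)
    rw [fanC_eq_neg, add_sub_cancel_right, ← h, neg_neg]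

/-! ### Switching curves -/

theorem exists_mem_Ioo_of_ae {P : ℝ → Prop} {l r : ℝ} (hlr : l < r)
    (h : ∀ᵐ t, t ∈ Ioo l r → P t) : ∃ t ∈ Ioo l r, P t := by
  by_contra! hn
  have h0 : volume (Ioo l r) = 0 := by
    rw [measure_eq_zero_iff_ae_notMem]
    filter_upwards [h] with t ht htm
    exact hn t htm (ht htm)
  rw [Real.volume_Ioo, ENNReal.ofReal_eq_zero] at h0
  linarith

/-- An optimal control takes the values of `bang a` arbitrarily close to each side of `t`. -/
theorem IsLeftUp.exists_bang_eq {x : ℝ × ℝ} {a τ : ℝ} (h : IsLeftUp x a τ) {u : ℝ → ℝ} {T : ℝ}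
    (hu : IsOptimal (usablePart square) x u T) {c l r l' r' : ℝ}
    (hc : ∀ᵐ s ∂(volume.restrict (Ioo l r)), u s = c) (hl : l ≤ l') (hr : r' ≤ r) (hl0 : 0 ≤ l')
    (hrT : r' ≤ T) (hlr : l' < r') : ∃ s ∈ Ioo l' r', bang a s = c := by
  obtain ⟨rfl, hb⟩ := h.eq_of_isOptimal hu
  rw [ae_restrict_iff' measurableSet_Ioo] at hc
  rw [ae_restrict_iff' measurableSet_Icc] at hb
  refine exists_mem_Ioo_of_ae hlr ?_
  filter_upwards [hc, hb] with s h1 h2 hs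
  rw [← h1 ⟨by linarith [hs.1], by linarith [hs.2]⟩,
    h2 ⟨by linarith [hs.1], by linarith [hs.2]⟩]

theorem bang_eq_one_iff {a t : ℝ} : bang a t = 1 ↔ t < a := by
  unfold bang; split_ifs with h <;> simp only [h]
  norm_num

theorem bang_eq_neg_one_iff {a t : ℝ} : bang a t = -1 ↔ a ≤ t := by
  unfold bang; split_ifs with h
  · simp only [not_le.mpr h]; norm_num
  · simpa using h

/-- If t ≠ a, an interval on one side of t would carry the wrong constant value of `bang a`. -/
theorem IsLeftUp.switch_eq {x : ℝ × ℝ} {a τ : ℝ} (h : IsLeftUp x a τ) {u : ℝ → ℝ} {T t ε : ℝ}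
    (hu : IsOptimal (usablePart square) x u T) (ht : t ∈ Ioo 0 T) (hε : 0 < ε)
    (h1 : ∀ᵐ s ∂(volume.restrict (Ioo (t - ε) t)), u s = 1)
    (h2 : ∀ᵐ s ∂(volume.restrict (Ioo t (t + ε))), u s = -1) : t = a := by
  rcases lt_trichotomy t a with hlt | rfl | hlt
  · obtain ⟨s, hs, hb⟩ := h.exists_bang_eq hu h2 (l' := t) (r' := min (min (t + ε) T) a) le_rfl
      ((min_le_left _ _).trans (min_le_left _ _)) ht.1.le
      ((min_le_left _ _).trans (min_le_right _ _))
      (lt_min (lt_min (by linarith) ht.2) hlt)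
    linarith [bang_eq_neg_one_iff.mp hb, (lt_min_iff.mp hs.2).2]
  · rfl
  · obtain ⟨s, hs, hb⟩ := h.exists_bang_eq hu h1 (l' := max (max (t - ε) 0) a) (r' := t)
      ((le_max_left _ _).trans (le_max_left _ _)) le_rfl
      ((le_max_right _ _).trans (le_max_left _ _)) ht.2.le
      (max_lt (max_lt (by linarith) ht.1) hlt)
    linarith [bang_eq_one_iff.mp hb, (max_lt_iff.mp hs.1).2]

theorem IsLeftUp.not_switch_up {x : ℝ × ℝ} {a τ : ℝ} (h : IsLeftUp x a τ) {u : ℝ → ℝ} {T t ε : ℝ}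
    (hu : IsOptimal (usablePart square) x u T) (ht : t ∈ Ioo 0 T) (hε : 0 < ε)
    (h1 : ∀ᵐ s ∂(volume.restrict (Ioo (t - ε) t)), u s = -1)
    (h2 : ∀ᵐ s ∂(volume.restrict (Ioo t (t + ε))), u s = 1) : False := by
  obtain ⟨s, hs, hb⟩ := h.exists_bang_eq hu h1 (l' := max (t - ε) 0) (r' := t)
    (le_max_left _ _) le_rfl (le_max_right _ _) ht.2.le (max_lt (by linarith) ht.1)
  obtain ⟨s', hs', hb'⟩ := h.exists_bang_eq hu h2 (l' := t) (r' := min (t + ε) T) le_rfl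
    (min_le_left _ _) ht.1.le (min_le_right _ _) (lt_min (by linarith) ht.2)
  linarith [bang_eq_neg_one_iff.mp hb, bang_eq_one_iff.mp hb', hs.2, hs'.1]

theorem switchPoints_one_neg_one :
    switchPoints 1 (-1) = {x | x.1 = -(1 / 2) * x.2 ^ 2 - 1 / 2 ∧ 1 < x.2} := by
  ext p
  constructor
  · rintro ⟨x, u, T, hx, hu, t, ht, rfl, ε, hε, h1, h2⟩
    rcases isLeftUp_or_neg hx with ⟨a, τ, h⟩ | ⟨a, τ, h⟩
    · obtain rfl := h.switch_eq hu ht hε h1 h2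
      obtain ⟨rfl, -⟩ := h.eq_of_isOptimal hu
      rw [h.traj_of_isOptimal hu ⟨ht.1.le, ht.2.le⟩]
      rcases h with ⟨s, σ, h, rfl, rfl⟩ | ⟨s, -, rfl, -⟩
      · rw [traj_leftPoint_of_le _ _ ht.1.le le_rfl]
        -- The switch precedes the terminal time, which rules out the motions without braking.
        have hσ : 0 < σ := by linarith [ht.2]
        rcases h.2.2.2.2 with rfl | ⟨rfl, -⟩
        · simp only [mem_ofPred_eq, leftPoint]
          constructor
          · ring
          · linarith
        · exact absurd hσ (lt_irrefl _)
      · exact absurd ht.1 (lt_irrefl _)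
    · refine (h.not_switch_up (isOptimal_usablePart_neg.mpr hu) ht hε ?_ ?_).elim
      · filter_upwards [h1] with s hs
        rw [Pi.neg_apply, hs]
      · filter_upwards [h2] with s hs
        rw [Pi.neg_apply, hs, neg_neg]
  · rintro ⟨hp1, hp2⟩
    have hσ : 0 < p.2 - 1 := sub_pos.mpr hp2
    -- Start one unit of time before p; braking from velocity `p.2` to 1 takes time `p.2 - 1`.
    have hl : IsLeftUp (leftPoint 1 (p.2 - 1) 1) 1 (1 + (p.2 - 1)) :=
      .inl ⟨1, p.2 - 1, leftParam_one hσ.le zero_le_one, rfl, rfl⟩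
    refine ⟨_, _, _, ?_, hl.isOptimal, 1, ⟨one_pos, by linarith⟩, ?_, 1, one_pos, ?_, ?_⟩
    · rw [mem_square]
      rintro ⟨⟨h, -⟩, -⟩
      simp only [leftPoint] at h
      nlinarith
    · rw [traj_leftPoint_of_le _ _ zero_le_one le_rfl]
      ext <;> simp only [leftPoint]
      · rw [hp1]; ring
      · ring
    · rw [ae_restrict_iff' measurableSet_Ioo]
      exact ae_of_all _ fun s hs => bang_eq_one_iff.mpr hs.2
    · rw [ae_restrict_iff' measurableSet_Ioo]
      exact ae_of_all _ fun s hs => bang_eq_neg_one_iff.mpr hs.1.le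

theorem neg_mem_switchPoints {a b : ℝ} {p : ℝ × ℝ} (h : p ∈ switchPoints a b) :
    -p ∈ switchPoints (-a) (-b) := by
  obtain ⟨x, u, T, hx, hu, t, ht, rfl, ε, hε, h1, h2⟩ := h
  refine ⟨-x, -u, T, fun h => hx (neg_mem_square_iff.mp h), isOptimal_usablePart_neg.mpr hu, t, ht,
    traj_neg x u t, ε, hε, ?_, ?_⟩
  · filter_upwards [h1] with s hs
    rw [Pi.neg_apply, hs]
  · filter_upwards [h2] with s hs
    rw [Pi.neg_apply, hs]

theorem switchPoints_neg_one_one :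
    switchPoints (-1) 1 = {x | x.1 = (1 / 2) * x.2 ^ 2 + 1 / 2 ∧ x.2 < -1} := by
  have key : ∀ p : ℝ × ℝ, p ∈ switchPoints (-1) 1 ↔ -p ∈ switchPoints 1 (-1) := fun p =>
    ⟨fun h => by simpa using neg_mem_switchPoints h, fun h => by
      simpa using neg_mem_switchPoints h⟩
  ext p
  rw [key, switchPoints_one_neg_one]
  simp only [mem_ofPred_eq, Prod.fst_neg, Prod.snd_neg]
  constructor <;> rintro ⟨h1, h2⟩ <;> constructor <;> linarith

theorem closure_graph (f : ℝ → ℝ) (hf : Continuous f) {s : Set ℝ} :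
    closure {x : ℝ × ℝ | x.1 = f x.2 ∧ x.2 ∈ s} = {x | x.1 = f x.2 ∧ x.2 ∈ closure s} := by
  apply subset_antisymm
  · refine closure_minimal (fun x hx => ⟨hx.1, subset_closure hx.2⟩) ?_
    exact (isClosed_eq continuous_fst (hf.comp continuous_snd)).inter
      (isClosed_closure.preimage continuous_snd)
  · rintro ⟨p, q⟩ ⟨h1, h2⟩
    simp only at h1 h2
    subst h1
    have hc : Continuous fun y : ℝ => (f y, y) := hf.prodMk continuous_id
    refine closure_mono ?_ (image_closure_subset_closure_image hc ⟨q, h2, rfl⟩)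
    rintro _ ⟨y, hy, rfl⟩
    exact ⟨rfl, hy⟩

theorem closure_switchPoints_one_neg_one :
    closure (switchPoints 1 (-1)) = {x | x.1 = -(1 / 2) * x.2 ^ 2 - 1 / 2 ∧ 1 ≤ x.2} := by
  rw [switchPoints_one_neg_one]
  have := closure_graph (fun y => -(1 / 2) * y ^ 2 - 1 / 2) (by fun_prop) (s := Ioi 1)
  rwa [closure_Ioi] at this

theorem closure_switchPoints_neg_one_one :
    closure (switchPoints (-1) 1) = {x | x.1 = (1 / 2) * x.2 ^ 2 + 1 / 2 ∧ x.2 ≤ -1} := by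
  rw [switchPoints_neg_one_one]
  have := closure_graph (fun y => (1 / 2) * y ^ 2 + 1 / 2) (by fun_prop) (s := Iio (-1))
  rwa [closure_Iio] at this

/-! ### Touch-and-go motions through B and D -/

theorem touchAndGo_arcB {x : ℝ × ℝ} (hx : x ∈ arcB) {u : ℝ → ℝ} {T : ℝ}
    (hu : IsOptimal (usablePart square) x u T) :
    T = 1 - x.2 ∧ traj x u (-1 - x.2) = cornerB ∧ traj x u T = cornerA ∧
      (∀ t ∈ Icc 0 T, traj x u t ∈ parabolaB) ∧
      (∀ t ∈ Icc 0 T, traj x u t ∈ square ↔ t = -1 - x.2 ∨ t = T) := by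
  obtain ⟨hp, hq⟩ := hx
  have hp : x.1 = x.2 ^ 2 / 2 - 3 / 2 := hp
  have hl : IsLeftUp x (1 - x.2) (1 - x.2) := by
    refine .inl ⟨1, 0, leftParam_one le_rfl (by linarith), ?_, by ring⟩
    ext <;> simp only [leftPoint]
    · rw [hp]; ring
    · ring
  obtain ⟨rfl, -⟩ := hl.eq_of_isOptimal hu
  have htr : ∀ t ∈ Icc 0 (1 - x.2), traj x u t = ((x.2 + t) ^ 2 / 2 - 3 / 2, x.2 + t) := by
    intro t ht
    rw [hl.traj_of_isOptimal hu ht, traj_bang_of_le _ ht.1 ht.2, hp]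
    ext <;> ring
  refine ⟨rfl, ?_, ?_, fun t ht => ?_, fun t ht => ?_⟩
  · rw [htr _ ⟨by linarith, by linarith⟩]
    ext <;> simp only [cornerB] <;> ring
  · rw [htr _ ⟨by linarith, le_rfl⟩]
    ext <;> simp only [cornerA] <;> ring
  · rw [htr t ht]; rfl
  · rw [htr t ht, mem_square]
    simp only
    constructor
    · rintro ⟨⟨h1, -⟩, h2, h3⟩
      -- On the parabola x₁ ≥ -1 means that the squared velocity is at least 1, while the square
      -- bounds it by 1.
      have : (x.2 + t + 1) * (x.2 + t - 1) = 0 := by nlinarith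
      rcases mul_eq_zero.mp this with h | h
      · left; linarith
      · right; linarith
    · rintro (rfl | rfl) <;> refine ⟨⟨?_, ?_⟩, ?_, ?_⟩ <;> ring_nf <;> norm_num

theorem touchAndGo_arcD {x : ℝ × ℝ} (hx : x ∈ arcD) {u : ℝ → ℝ} {T : ℝ}
    (hu : IsOptimal (usablePart square) x u T) :
    T = 1 + x.2 ∧ traj x u (x.2 - 1) = cornerD ∧ traj x u T = cornerC ∧
      (∀ t ∈ Icc 0 T, traj x u t ∈ parabolaD) ∧
      (∀ t ∈ Icc 0 T, traj x u t ∈ square ↔ t = x.2 - 1 ∨ t = T) := by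
  obtain ⟨h1, h2, h3, h4, h5⟩ :=
    touchAndGo_arcB (neg_mem_arcB_iff.mpr hx) (isOptimal_usablePart_neg.mpr hu)
  have e : -1 - (-x).2 = x.2 - 1 := by simp only [Prod.snd_neg]; ring
  rw [e] at h2 h5
  simp only [traj_neg, neg_mem_square_iff] at h2 h3 h4 h5
  refine ⟨by rw [h1]; simp, ?_, ?_, fun t ht => ?_, h5⟩
  · rw [neg_eq_iff_eq_neg.mp h2]; ext <;> simp [cornerB, cornerD]
  · rw [neg_eq_iff_eq_neg.mp h3]; ext <;> simp [cornerA, cornerC]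
  · have := h4 t ht
    simp only [parabolaB, parabolaD, mem_ofPred_eq, Prod.fst_neg, Prod.snd_neg] at this ⊢
    linarith

theorem IsLeftUp.mem_arcB_of_cornerB {x : ℝ × ℝ} {a τ : ℝ} (h : IsLeftUp x a τ) (hx : x ∉ square)
    {t : ℝ} (ht : t ∈ Icc 0 τ) (hB : traj x (bang a) t = cornerB) : x ∈ arcB := by
  rcases h with ⟨s, σ, h, rfl, rfl⟩ | ⟨s, hs, rfl, h, rfl⟩
  · rcases le_total t a with hta | hta
    · rw [traj_leftPoint_of_le _ _ ht.1 hta] at hB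
      have e1 := congrArg Prod.fst hB
      have e2 := congrArg Prod.snd hB
      simp only [leftPoint, cornerB] at e1 e2
      obtain ⟨h1, h2, h3, h4, h5⟩ := h
      -- Without braking, velocity -1 occurs at remaining time s + 1, which is at most 2s only if s
      -- = 1.
      obtain rfl : s = 1 := h5.elim id fun h5 => by linarith [ht.1, h5.1, h5.2]
      have hr : a - t = 2 + σ := by linarith
      rw [hr] at e1
      -- At velocity -1 the abscissa is -1 - 2σ - σ², which is that of B only if σ = 0.
      obtain rfl : σ = 0 := by nlinarith
      have ha : 2 ≤ a := by linarith [ht.1]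
      rcases ha.eq_or_lt with rfl | ha
      · refine absurd (mem_square.mpr ?_) hx
        simp only [leftPoint]
        norm_num
      · constructor
        · simp only [parabolaB, mem_ofPred_eq, leftPoint]; ring
        · simp only [leftPoint]; linarith
    · rw [traj_leftPoint_of_ge _ _ h.2.2.2.1 hta] at hB
      have e2 := congrArg Prod.snd hB
      simp only [leftPoint, cornerB] at e2
      linarith [h.1, ht.2]
  · rw [traj_famAD _ ht.1] at hB
    have e2 := congrArg Prod.snd hB
    simp only [famAD, cornerB] at e2
    linarith [ht.2]

/-- Needed for the mirror images: by symmetry, a motion ending on BC, on CD or at C avoids B. -/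
theorem IsLeftUp.traj_ne_cornerD {x : ℝ × ℝ} {a τ : ℝ} (h : IsLeftUp x a τ)
    {t : ℝ} (ht : t ∈ Icc 0 τ) : traj x (bang a) t ≠ cornerD := by
  intro hD
  rcases h with ⟨s, σ, h, rfl, rfl⟩ | ⟨s, hs, rfl, h, rfl⟩
  · rcases lt_or_ge t a with hta | hta
    · rw [traj_leftPoint_of_le _ _ ht.1 hta.le] at hD
      have hr := h.mono (r := a - t) (by linarith) (by linarith [ht.1])
      rcases hr.leftPoint_cases (by linarith [h.2.2.1]) with h' | h' | ⟨-, -, h'⟩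
      · rw [hD] at h'; norm_num [cornerD] at h'
      · rw [hD] at h'; norm_num [cornerD] at h'
      · rw [hD] at h'; norm_num [cornerD] at h'
    · rw [traj_leftPoint_of_ge _ _ h.2.2.2.1 hta] at hD
      have e1 := congrArg Prod.fst hD
      simp only [leftPoint, cornerD] at e1
      have : 0 ≤ σ - (t - a) := by linarith [ht.2]
      nlinarith [h.1]
  · rw [traj_famAD _ ht.1] at hD
    have e1 := congrArg Prod.fst hD
    have e2 := congrArg Prod.snd hD
    simp only [famAD, cornerD] at e1 e2
    have : τ - t = 0 := by linarith
    rw [this] at e1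
    linarith [hs.2]

theorem IsLeftUp.corner_cases {x : ℝ × ℝ} {a τ : ℝ} (h : IsLeftUp x a τ) (hx : x ∉ square)
    {u : ℝ → ℝ} {T : ℝ} (hu : IsOptimal (usablePart square) x u T) {t : ℝ} (ht : t ∈ Icc 0 T) :
    (traj x u t = cornerB → x ∈ arcB) ∧ traj x u t ≠ cornerD := by
  obtain ⟨rfl, -⟩ := h.eq_of_isOptimal hu
  rw [h.traj_of_isOptimal hu ht]
  exact ⟨h.mem_arcB_of_cornerB hx ht, h.traj_ne_cornerD ht⟩

theorem cornerD_eq_neg : cornerD = -cornerB := by ext <;> simp [cornerB, cornerD]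

theorem corner_touch {x : ℝ × ℝ} (hx : x ∉ square) {u : ℝ → ℝ} {T : ℝ}
    (hu : IsOptimal (usablePart square) x u T) {t : ℝ} (ht : t ∈ Icc 0 T) :
    (traj x u t = cornerB → x ∈ arcB) ∧ (traj x u t = cornerD → x ∈ arcD) := by
  rcases isLeftUp_or_neg hx with ⟨a, τ, h⟩ | ⟨a, τ, h⟩
  · have := h.corner_cases hx hu ht
    exact ⟨this.1, fun h => absurd h this.2⟩
  · have := h.corner_cases (fun h => hx (neg_mem_square_iff.mp h))
      (isOptimal_usablePart_neg.mpr hu) ht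
    rw [traj_neg, neg_mem_arcB_iff] at this
    refine ⟨fun h => absurd ?_ this.2, fun h => this.1 ?_⟩
    · rw [h, cornerD_eq_neg]
    · rw [h, cornerD_eq_neg, neg_neg]

/-! ### Results on the whole exterior -/

theorem hasFeedbackSynthesis {x : ℝ × ℝ} (hx : x ∉ square) : HasFeedbackSynthesis feedback x := by
  rcases isLeftUp_or_neg hx with ⟨a, τ, h⟩ | ⟨a, τ, h⟩
  · exact h.hasFeedbackSynthesis isSynthesis_feedback
  · exact (h.hasFeedbackSynthesis isSynthesis_neg_feedback_neg).neg

theorem isOptimal_square_iff {x : ℝ × ℝ} (hx : x ∉ square) (hB : x ∉ arcB) (hD : x ∉ arcD)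
    (u : ℝ → ℝ) (T : ℝ) : IsOptimal square x u T ↔ IsOptimal (usablePart square) x u T := by
  rcases isLeftUp_or_neg hx with ⟨a, τ, h⟩ | ⟨a, τ, h⟩
  · exact h.isOptimal_square_iff hx hB u T
  · rw [← isOptimal_usablePart_neg, ← isOptimal_neg fun _ => neg_mem_square]
    exact h.isOptimal_square_iff (fun h => hx (neg_mem_square_iff.mp h))
      (fun h => hD (neg_mem_arcB_iff.mp h)) _ _

theorem cornerB_notMem_usablePart : cornerB ∉ usablePart square := by
  rw [mem_usablePart]
  norm_num [cornerB]

theorem cornerD_notMem_usablePart : cornerD ∉ usablePart square := by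
  rw [mem_usablePart]
  norm_num [cornerD]

end SquareTarget

theorem mainTheorem3 :
    -- the usable part
    (usablePart square =
      {x | x.1 = -1 ∧ x.2 ∈ Ioc 0 1} ∪ {x | x.1 ∈ Ioc (-1) 1 ∧ x.2 = -1} ∪
      {x | x.1 = 1 ∧ x.2 ∈ Ico (-1) 0} ∪ {x | x.1 ∈ Ico (-1) 1 ∧ x.2 = 1}) ∧
    -- existence, uniqueness and bang-bang feedback synthesis of the minimum-time control
    (∀ x₀, x₀ ∉ square →
      (∃ u T, IsOptimal (usablePart square) x₀ u T) ∧
      (∀ u T v S, IsOptimal (usablePart square) x₀ u T → IsOptimal (usablePart square) x₀ v S →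
        T = S ∧ ∀ᵐ t ∂(volume.restrict (Icc 0 T)), u t = v t) ∧
      (∀ u T, IsOptimal (usablePart square) x₀ u T ↔
        Steers (usablePart square) x₀ u T ∧
        (∀ t ∈ Ico 0 T, traj x₀ u t ∉ usablePart square) ∧
        ∀ᵐ t ∂(volume.restrict (Icc 0 T)), u t = feedback (traj x₀ u t))) ∧
    -- away from two exceptional arcs, this is also the solution for the whole square as target
    (∀ x₀, x₀ ∉ square → x₀ ∉ arcB → x₀ ∉ arcD →
      ∀ u T, IsOptimal square x₀ u T ↔ IsOptimal (usablePart square) x₀ u T) ∧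
    -- the families of optimal motions ending on the sides, and the fans ending at `A` and `C`
    (∀ s ∈ Ioc (0 : ℝ) 1, ∀ τ ∈ Icc 0 (2 * s), IsOptimalMotion (famAB s) τ) ∧
    (∀ s ∈ Ioc (-1 : ℝ) 1, ∀ τ ≥ 0, IsOptimalMotion (famBC s) τ) ∧
    (∀ s ∈ Ico (-1 : ℝ) 0, ∀ τ ∈ Icc 0 (-2 * s), IsOptimalMotion (famCD s) τ) ∧
    (∀ s ∈ Ico (-1 : ℝ) 1, ∀ τ ≥ 0, IsOptimalMotion (famAD s) τ) ∧
    (∀ θ ∈ Ioc (Real.pi / 2) Real.pi, ∀ τ ≥ 0, IsOptimalMotion (fanA θ) τ) ∧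
    (∀ θ ∈ Ioc (3 * Real.pi / 2) (2 * Real.pi), ∀ τ ≥ 0, IsOptimalMotion (fanC θ) τ) ∧
    -- these motions fill the exterior of the square
    (∀ x₀, x₀ ∉ square →
      (∃ s ∈ Ioc (0 : ℝ) 1, ∃ τ ∈ Icc 0 (2 * s), x₀ = famAB s τ) ∨
      (∃ s ∈ Ioc (-1 : ℝ) 1, ∃ τ ≥ 0, x₀ = famBC s τ) ∨
      (∃ s ∈ Ico (-1 : ℝ) 0, ∃ τ ∈ Icc 0 (-2 * s), x₀ = famCD s τ) ∨
      (∃ s ∈ Ico (-1 : ℝ) 1, ∃ τ ≥ 0, x₀ = famAD s τ) ∨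
      (∃ θ ∈ Ioc (Real.pi / 2) Real.pi, ∃ τ ≥ 0, x₀ = fanA θ τ) ∨
      (∃ θ ∈ Ioc (3 * Real.pi / 2) (2 * Real.pi), ∃ τ ≥ 0, x₀ = fanC θ τ)) ∧
    -- the two switching curves; their end points `A`, `C` belong to the closure
    (switchPoints 1 (-1) = {x | x.1 = -(1 / 2) * x.2 ^ 2 - 1 / 2 ∧ 1 < x.2}) ∧
    (closure (switchPoints 1 (-1)) = {x | x.1 = -(1 / 2) * x.2 ^ 2 - 1 / 2 ∧ 1 ≤ x.2}) ∧
    (switchPoints (-1) 1 = {x | x.1 = (1 / 2) * x.2 ^ 2 + 1 / 2 ∧ x.2 < -1}) ∧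
    (closure (switchPoints (-1) 1) = {x | x.1 = (1 / 2) * x.2 ^ 2 + 1 / 2 ∧ x.2 ≤ -1}) ∧
    -- touch-and-go motions through `B` and `D`
    (cornerB ∉ usablePart square ∧ cornerD ∉ usablePart square) ∧
    (∀ x₀ ∈ arcB, ∀ u T, IsOptimal (usablePart square) x₀ u T →
      T = 1 - x₀.2 ∧ traj x₀ u (-1 - x₀.2) = cornerB ∧ traj x₀ u T = cornerA ∧
      (∀ t ∈ Icc 0 T, traj x₀ u t ∈ parabolaB) ∧
      (∀ t ∈ Icc 0 T, traj x₀ u t ∈ square ↔ t = -1 - x₀.2 ∨ t = T)) ∧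
    (∀ x₀ ∈ arcD, ∀ u T, IsOptimal (usablePart square) x₀ u T →
      T = 1 + x₀.2 ∧ traj x₀ u (x₀.2 - 1) = cornerD ∧ traj x₀ u T = cornerC ∧
      (∀ t ∈ Icc 0 T, traj x₀ u t ∈ parabolaD) ∧
      (∀ t ∈ Icc 0 T, traj x₀ u t ∈ square ↔ t = x₀.2 - 1 ∨ t = T)) ∧
    (∀ x₀, x₀ ∉ square → ∀ u T, IsOptimal (usablePart square) x₀ u T → ∀ t ∈ Icc 0 T,
      (traj x₀ u t = cornerB → x₀ ∈ arcB) ∧ (traj x₀ u t = cornerD → x₀ ∈ arcD)) := by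
  refine ⟨usablePart_square_eq, fun x hx => hasFeedbackSynthesis hx,
    fun x hx hB hD => isOptimal_square_iff hx hB hD, fun s hs τ hτ => isOptimalMotion_famAB hs hτ,
    fun s hs τ hτ => ?_, fun s hs τ hτ => ?_, fun s hs τ hτ => isOptimalMotion_famAD hs hτ,
    fun θ hθ τ hτ => isOptimalMotion_fanA hθ hτ, fun θ hθ τ hτ => ?_, fun x hx => ?_,
    switchPoints_one_neg_one, closure_switchPoints_one_neg_one, switchPoints_neg_one_one,
    closure_switchPoints_neg_one_one, ⟨cornerB_notMem_usablePart, cornerD_notMem_usablePart⟩,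
    fun x hx u T hu => touchAndGo_arcB hx hu, fun x hx u T hu => touchAndGo_arcD hx hu,
    fun x hx u T hu t ht => corner_touch hx hu ht⟩
  · exact (isOptimalMotion_famAD (s := -s) ⟨by linarith [hs.2], by linarith [hs.1]⟩ hτ).neg
      (famBC_eq_neg s)
  · exact (isOptimalMotion_famAB (s := -s) ⟨by linarith [hs.2], by linarith [hs.1]⟩
      ⟨hτ.1, by linarith [hτ.2]⟩).neg (famCD_eq_neg s)
  · exact (isOptimalMotion_fanA (θ := θ - Real.pi) ⟨by linarith [hθ.1], by linarith [hθ.2]⟩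
      hτ).neg (fanC_eq_neg θ)
  · rcases leftUpCovered_or_neg hx with (h | h | h) | h
    · exact .inl h
    · exact .inr (.inr (.inr (.inl h)))
    · exact .inr (.inr (.inr (.inr (.inl h))))
    · rcases h.neg_cases with h | h | h
      · exact .inr (.inl h)
      · exact .inr (.inr (.inl h))
      · exact .inr (.inr (.inr (.inr (.inr h))))
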